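/- **Conventions.** Graphs are finite and simple. In a half-edge labelled graph, every pair $(u,e)$ with $u\in e$ carries a label $L_u(e)$. For labels $L_1,\dots,L_k$, $f(u,L_1,\dots,L_k)$ is the endpoint of the walk from $u$ whose successive half-edges, in the direction of travel, are labelled $L_1,\dots,L_k$, if such a walk exists and is unique; otherwise it is $\bot$ (does not exist). "$u$ has $\ell$" means that some half-edge at $u$ is labelled $\ell$. **$\mathcal C^{\mathsf{tree}}$ at $u$** (labels $\mathsf L,\mathsf R,\mathsf P,\mathsf{Ch_L},\mathsf{Ch_R}$): (1) distinct edges at $u$ have distinct labels at $u$; (2) on each edge at $u$, one half is $\mathsf L$ iff the other is $\mathsf R$; (3) on each edge at $u$, one half is $\mathsf P$ iff the other is in $\{\mathsf{Ch_L},\mathsf{Ch_R}\}$; (4) if $L_u(e)=\mathsf P$, $L_v(e)=\mathsf{Ch_L}$ for an edge $e=\{u,v\}$, then $f(u,\mathsf P,\mathsf{Ch_R},\mathsf L)=u$; (5) if $L_u(e)=\mathsf P$, $L_v(e)=\mathsf{Ch_R}$ and $u$ has $\mathsf R$, then $f(u,\mathsf P,\mathsf R,\mathsf{Ch_L},\mathsf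 L)=u$; (6) $u$ has $\mathsf{Ch_L}$ iff it has $\mathsf{Ch_R}$; (7) $u$ lacks $\mathsf P$ iff it lacks both $\mathsf L$ and $\mathsf R$; (8) if $u$ has neither $\mathsf{Ch_L}$ nor $\mathsf{Ch_R}$, then neither do $f(u,\mathsf L)$, $f(u,\mathsf R)$, if they exist; (9) if $L_u(e)=\mathsf P$ and $L_v(e)=\mathsf{Ch_R}$ (resp. $\mathsf{Ch_L}$), then $u$ has $\mathsf R$ (resp. $\mathsf L$) iff $f(u,\mathsf P)$ does. **$\mathcal C^{\mathsf{vGrid}}$ at $u$** (half-edge labels $\mathsf U,\mathsf D,\mathsf L,\mathsf R$; some nodes are labelled $1$): (1) distinct edges at $u$ have distinct labels at $u$; (2) on each edge at $u$, one half is $\mathsf L$ iff the other is $\mathsf R$, and one half is $\mathsf U$ iff the other is $\mathsf D$; (3) if $u$ has $\mathsf R$ and $\mathsf U$, then $f(u,\mathsf R,\mathsf U,\mathsf L,\mathsf D)=u$; (4) if $f(u,\mathsf R)$ exists, it has $\mathsf D$ (resp. $\mathsf U$) iff $u$ does; if $f(u,\mathsf U)$ exists, it has $\mathsf L$ (resp.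 $\mathsf R$) iff $u$ does; (5) if $u$ is labelled $1$, so are $f(u,\mathsf U,\mathsf R)$ and $f(u,\mathsf D,\mathsf L)$ if they exist; if moreover $f(u,\mathsf D)=\bot$ then $f(u,\mathsf L)=\bot$; and if $f(u,\mathsf U)=\bot$ then $f(u,\mathsf R)=\bot$. **$\mathcal C^{\mathsf{badTree}}$ at $u$**, for a graph with half-edge labels as in $\mathcal C^{\mathsf{tree}}$, some nodes marked, and outputs in $\{\bot,\mathsf{Error}\}\cup\{(\mathsf{pointer},p): p\in\{\mathsf L,\mathsf R,\mathsf P,\mathsf{Ch_R}\}\}$: output $\mathsf{Error}$ is allowed only if $u$ violates $\mathcal C^{\mathsf{tree}}$ or is marked; if $u$ outputs $(\mathsf{pointer},p)$, then $v=f(u,p)$ exists and outputs either $\mathsf{Error}$ or some $(\mathsf{pointer},p')$ with $f(v,p)\ne u$ and with $p'=p$ if $p\in\{\mathsf L,\mathsf R\}$, $p'\in\{p,\mathsf L,\mathsf R\}$ if $p\in\{\mathsf P,\mathsf{Ch_R}\}$. **The problem $\Pi$.** *Input:* each node gets a label $(\mathsf{treeNode})$ or $(\mathsf{treeNode},\mathsf{gridNode},\ell)$,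 $\ell\in\{0,1\}$, and a bit $b_{\mathrm{in}}$. Each half-edge gets $(\mathsf{treeEdge},\ell)$ with $\ell\in\{\mathsf L,\mathsf R,\mathsf P,\mathsf{Ch_L},\mathsf{Ch_R}\}$, $(\mathsf{gridEdge},\mathsf L)$, $(\mathsf{gridEdge},\mathsf R)$, $((\mathsf{gridEdge},\mathsf D),(\mathsf{treeEdge},\mathsf L))$ or $((\mathsf{gridEdge},\mathsf U),(\mathsf{treeEdge},\mathsf R))$. The type of a half-edge label is the subset of $\{\mathsf{treeEdge},\mathsf{gridEdge}\}$ occurring in it. Let $G_{\mathsf{tree}}$ (resp. $G_{\mathsf{grid}}$) be the graph on all nodes formed by the edges whose two half-edges have the same type and this type contains $\mathsf{treeEdge}$ (resp. $\mathsf{gridEdge}$), with half-edges labelled by their $\mathsf{treeEdge}$ (resp. $\mathsf{gridEdge}$) component. *Output* of each node: one of the *bad* labels $\mathsf{Error},\mathsf{TreeError},\mathsf{GridError},\mathsf{VertError}$, $(\mathsf{ColumnError},\ell)$ with $\ell\ne\bot$ an output label of $\mathcal C^{\mathsf{badTree}}$; or a pair in $\{0,1\}\times\{\mathsf{yes},\mathsf{no}\}$;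 or $\mathsf{yes}$ or $\mathsf{no}$. *Constraints* at each node $u$: 1. $\mathsf{Error}$ only if some edge at $u$ has half-edges of different types, or $u$ has input $(\mathsf{treeNode})$ and an incident half-edge whose type contains $\mathsf{gridEdge}$. $\mathsf{TreeError}$ only if $u$ violates $\mathcal C^{\mathsf{tree}}$ in $G_{\mathsf{tree}}$. $\mathsf{GridError}$ only if the input of $u$ is not $(\mathsf{treeNode})$ and $u$ violates $\mathcal C^{\mathsf{vGrid}}$ in $G_{\mathsf{grid}}$, where exactly the nodes with input $(\mathsf{treeNode},\mathsf{gridNode},1)$ are labelled $1$. $\mathsf{VertError}$ only if the input of $u$ is not $(\mathsf{treeNode},\mathsf{gridNode},1)$ and all its neighbours in $G_{\mathsf{tree}}$ output $\mathsf{VertError}$. Moreover, $\mathcal C^{\mathsf{badTree}}$ holds at $u$ in $G_{\mathsf{tree}}$, where the nodes with output $\mathsf{Error},\mathsf{TreeError},\mathsf{GridError}$ are marked and count as outputting $\mathsf{Error}$, output $(\mathsf{ColumnError},\ell)$ counts as $\ell$, and every other output counts as $\bot$. 2. If $u$ has input $(\mathsf{treeNode},\mathsf{gridNode},\ell)$,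 its output is bad or a pair; if it has input $(\mathsf{treeNode})$, its output is bad or in $\{\mathsf{yes},\mathsf{no}\}$. 3. If $u$ outputs $(b,x)$: if $v=f(u,(\mathsf{gridEdge},\mathsf R))$ exists, then $v$ outputs a bad label or $(b,x')$ for some $x'$; if it does not exist, then $x=\mathsf{yes}$ iff $b=b_{\mathrm{in}}(u)$. 4. If $u$ outputs $x\in\{\mathsf{yes},\mathsf{no}\}$: those of $f(u,(\mathsf{treeEdge},\mathsf{Ch_L}))$ and $f(u,(\mathsf{treeEdge},\mathsf{Ch_R}))$ that exist have outputs that are not bad, and $x=\mathsf{yes}$ iff at least one of them outputs $\mathsf{yes}$ or a pair with second component $\mathsf{yes}$; if $f(u,(\mathsf{treeEdge},\mathsf P))=\bot$, then $x=\mathsf{yes}$. **The randomized SLOCAL model with private randomness.** The network is an input-labelled graph with $n$ nodes, possibly disconnected, with distinct identifiers in $\{1,\dots,n^c\}$ for a constant $c\ge 1$. An adversary fixes an ordering of the nodes, in which they are processed. When $v$ is processed, an algorithm of locality $T$ sees $n$, the nodes within distance $T$ of $v$ with their identifiers, inputs and incident half-edges (with labels and the identifiers of the other endpoints), and the current memory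 of these nodes; from this and from a private infinite sequence of fair random bits (independent for different nodes) it computes, by a measurable but otherwise arbitrary rule, the new memory of $v$, of unbounded size, which includes the final output of $v$. An algorithm *solves $\Pi$ on $n$-node networks with locality $T$* if for every $n$-node network whose input admits at least one valid solution of $\Pi$, and every processing order, the outputs form a valid solution with probability at least $1-1/n$. **Theorem.** In the randomized SLOCAL model with private randomness, solving $\Pi$ requires locality $\Omega(\sqrt n)$. That is, there are constants $C>0$ and $n_0$ such that for every $c\ge 1$, every algorithm, every function $T:\mathbb N\to\mathbb N$ and every $n\ge n_0$: if the algorithm solves $\Pi$ on $n$-node networks with locality $T(n)$, then $T(n)\ge C\sqrt n$. -/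

import Mathlib

namespace PiProblem

/-! ### Half-edge labelled graphs

A graph on `V` is a `SimpleGraph V`.  A half-edge labelling is a function `L : V → V → Λ`: the
half-edge `(u, {u, v})` carries the label `L u v`.  Only the values at adjacent pairs are ever
consulted. -/

section Labelled

variable {V Λ : Type*}

/-- `Trace G L u ls vs`: `u, vs₁, vs₂, …` is a walk in `G` whose successive half-edges, in the
direction of travel, carry the labels `ls`. -/
def Trace (G : SimpleGraph V) (L : V → V → Λ) : V → List Λ → List V → Prop
  | _, [], [] => True
  | u, l :: ls, v :: vs => G.Adj u v ∧ L u v = l ∧ Trace G L v ls vs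
  | _, _, _ => False

/-- `f(u, ls) = v`: the walk from `u` along the labels `ls` exists, is unique, and ends in `v`.
Accordingly `f(u, ls) = ⊥` is `¬ ∃ v, Leads G L u ls v`. -/
def Leads (G : SimpleGraph V) (L : V → V → Λ) (u : V) (ls : List Λ) (v : V) : Prop :=
  (∃! vs, Trace G L u ls vs) ∧ ∃ vs, Trace G L u ls vs ∧ (u :: vs).getLast? = some v

/-- The node `u` has an incident half-edge labelled `l`. -/
def Has (G : SimpleGraph V) (L : V → V → Λ) (u : V) (l : Λ) : Prop :=
  ∃ v, G.Adj u v ∧ L u v = l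

end Labelled

/-! ### Label sets -/

/-- Half-edge labels of tree-like structures. -/
inductive TreeLabel
  | L | R | P | ChL | ChR
  deriving DecidableEq

/-- Half-edge labels of grid structures. -/
inductive GridLabel
  | U | D | L | R
  deriving DecidableEq

/-- The two kinds of edges. -/
inductive EdgeKind
  | treeEdge | gridEdge
  deriving DecidableEq

/-- Input half-edge labels: `(treeEdge, ℓ)`, `(gridEdge, L)`, `(gridEdge, R)`,
`((gridEdge, D), (treeEdge, L))` and `((gridEdge, U), (treeEdge, R))`. -/
inductive EdgeLabel
  | tree (l : TreeLabel)
  | gridL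
  | gridR
  | gridDTreeL
  | gridUTreeR
  deriving DecidableEq

/-- The type of a half-edge label. -/
def EdgeLabel.type : EdgeLabel → Finset EdgeKind
  | .tree _ => {.treeEdge}
  | .gridL => {.gridEdge}
  | .gridR => {.gridEdge}
  | .gridDTreeL => {.treeEdge, .gridEdge}
  | .gridUTreeR => {.treeEdge, .gridEdge}

/-- The tree value of a half-edge label (`none` where undefined). -/
def EdgeLabel.valT : EdgeLabel → Option TreeLabel
  | .tree l => some l
  | .gridL => none
  | .gridR => none
  | .gridDTreeL => some .L
  | .gridUTreeR => some .R

/-- The grid value of a half-edge label (`none` where undefined). -/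
def EdgeLabel.valG : EdgeLabel → Option GridLabel
  | .tree _ => none
  | .gridL => some .L
  | .gridR => some .R
  | .gridDTreeL => some .D
  | .gridUTreeR => some .U

/-- Input node labels for `badGraph`: `(treeNode)` and `(treeNode, gridNode, ℓ)`, `ℓ ∈ {0, 1}`. -/
inductive NodeLabel
  | treeNode
  | gridNode (l : Bool)
  deriving DecidableEq

/-- Directions of pointers. -/
inductive PointerDir
  | L | R | P | ChR
  deriving DecidableEq

def PointerDir.toLabel : PointerDir → TreeLabel
  | .L => .L
  | .R => .R
  | .P => .P
  | .ChR => .ChR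

/-- Output labels of `badTree` other than `⊥`; the full output set is `Option BadTreeProof`,
with `none` for `⊥`. -/
inductive BadTreeProof
  | error
  | pointer (p : PointerDir)
  deriving DecidableEq

/-- Output labels of `badGraph` other than `⊥`; the full output set is `Option BadGraphProof`,
with `none` for `⊥` (which is identified with `(ColumnError, ⊥)`). -/
inductive BadGraphProof
  | error
  | treeError
  | gridError
  | columnError (l : BadTreeProof)
  | vertError
  deriving DecidableEq

/-- Output labels of `Π`: the non-empty outputs of `badGraph`, the pairs in
`{0,1} × {yes, no}`, and `yes`, `no` (`true` stands for `1` and for `yes`). -/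
inductive PiOutput
  | bad (o : BadGraphProof)
  | grid (b : Bool) (x : Bool)
  | tree (x : Bool)
  deriving DecidableEq

/-! ### Local constraints -/

section Constraints

variable {V : Type*}

/-- The constraints `C^tree` at the node `u`. -/
structure TreeOK (G : SimpleGraph V) (L : V → V → Option TreeLabel) (u : V) : Prop where
  distinct : ∀ v w, G.Adj u v → G.Adj u w → v ≠ w → L u v ≠ L u w
  left_right : ∀ v, G.Adj u v →
    (L u v = some .L ↔ L v u = some .R) ∧ (L u v = some .R ↔ L v u = some .L)
  parent_child : ∀ v, G.Adj u v →
    (L u v = some .P ↔ L v u = some .ChL ∨ L v u = some .ChR) ∧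
    (L v u = some .P ↔ L u v = some .ChL ∨ L u v = some .ChR)
  triangle : ∀ v, G.Adj u v → L u v = some .P → L v u = some .ChL →
    Leads G L u [some .P, some .ChR, some .L] u
  square : ∀ v, G.Adj u v → L u v = some .P → L v u = some .ChR → Has G L u (some .R) →
    Leads G L u [some .P, some .R, some .ChL, some .L] u
  two_children : Has G L u (some .ChL) ↔ Has G L u (some .ChR)
  root : ¬ Has G L u (some .P) ↔ ¬ Has G L u (some .L) ∧ ¬ Has G L u (some .R)
  boundary_children : ¬ Has G L u (some .ChL) → ¬ Has G L u (some .ChR) →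
    ∀ v, Leads G L u [some .L] v ∨ Leads G L u [some .R] v →
      ¬ Has G L v (some .ChL) ∧ ¬ Has G L v (some .ChR)
  boundary_right : ∀ v, G.Adj u v → L u v = some .P → L v u = some .ChR →
    (Has G L u (some .R) ↔ ∃ w, Leads G L u [some .P] w ∧ Has G L w (some .R))
  boundary_left : ∀ v, G.Adj u v → L u v = some .P → L v u = some .ChL →
    (Has G L u (some .L) ↔ ∃ w, Leads G L u [some .P] w ∧ Has G L w (some .L))

/-- The constraints `C^grid` at the node `u`. -/
structure GridOK (G : SimpleGraph V) (L : V → V → Option GridLabel) (u : V) : Prop where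
  distinct : ∀ v w, G.Adj u v → G.Adj u w → v ≠ w → L u v ≠ L u w
  left_right : ∀ v, G.Adj u v →
    (L u v = some .L ↔ L v u = some .R) ∧ (L u v = some .R ↔ L v u = some .L)
  up_down : ∀ v, G.Adj u v →
    (L u v = some .U ↔ L v u = some .D) ∧ (L u v = some .D ↔ L v u = some .U)
  square : Has G L u (some .R) → Has G L u (some .U) →
    Leads G L u [some .R, some .U, some .L, some .D] u
  down_propagates : ∀ v, Leads G L u [some .R] v →
    (Has G L u (some .D) ↔ Has G L v (some .D)) ∧ (Has G L u (some .U) ↔ Has G L v (some .U))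
  left_propagates : ∀ v, Leads G L u [some .U] v →
    (Has G L u (some .L) ↔ Has G L v (some .L)) ∧ (Has G L u (some .R) ↔ Has G L v (some .R))

/-- The constraints `C^vGrid` at the node `u`; `one v` says that `v` carries the label `1`. -/
structure VGridOK (G : SimpleGraph V) (L : V → V → Option GridLabel) (one : V → Prop) (u : V) :
    Prop where
  grid : GridOK G L u
  diagonal : one u → ∀ v, Leads G L u [some .U, some .R] v ∨ Leads G L u [some .D, some .L] v →
    one v
  bottom : one u → (¬ ∃ v, Leads G L u [some .D] v) → ¬ ∃ v, Leads G L u [some .L] v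
  top : one u → (¬ ∃ v, Leads G L u [some .U] v) → ¬ ∃ v, Leads G L u [some .R] v

/-- `p'` may follow `p` along a chain of pointers. -/
def PointerDir.Compatible : PointerDir → PointerDir → Prop
  | .L, p' => p' = .L
  | .R, p' => p' = .R
  | .P, p' => p' = .P ∨ p' = .L ∨ p' = .R
  | .ChR, p' => p' = .ChR ∨ p' = .L ∨ p' = .R

/-- The constraints `C^badTree` at the node `u`. -/
structure BadTreeOK (G : SimpleGraph V) (L : V → V → Option TreeLabel) (marked : V → Prop)
    (out : V → Option BadTreeProof) (u : V) : Prop where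
  error : out u = some .error → ¬ TreeOK G L u ∨ marked u
  pointer : ∀ p, out u = some (.pointer p) → ∃ v, Leads G L u [some p.toLabel] v ∧
    (out v = some .error ∨
      ∃ p', out v = some (.pointer p') ∧ ¬ Leads G L v [some p.toLabel] u ∧ p.Compatible p')

/-- The graph formed by the edges whose type (the common type of its two half-edges, and `∅` if
the two differ) contains `k`. -/
def kindGraph (G : SimpleGraph V) (half : V → V → EdgeLabel) (k : EdgeKind) : SimpleGraph V where
  Adj u v := G.Adj u v ∧ (half u v).type = (half v u).type ∧ k ∈ (half u v).type
  symm := ⟨fun _ _ h => ⟨h.1.symm, h.2.1.symm, h.2.1 ▸ h.2.2⟩⟩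
  loopless := ⟨fun _ h => G.loopless.irrefl _ h.1⟩

/-- Reading a `badGraph` output as a `badTree` output. -/
def toBadTree : Option BadGraphProof → Option BadTreeProof
  | some .error => some .error
  | some .treeError => some .error
  | some .gridError => some .error
  | some (.columnError l) => some l
  | some .vertError => none
  | none => none

/-- The outputs that mark a node for `badTree`. -/
def IsMark (o : Option BadGraphProof) : Prop :=
  o = some .error ∨ o = some .treeError ∨ o = some .gridError

/-- The constraints `C^badGraph` at the node `u`. -/
structure BadGraphOK (G : SimpleGraph V) (inp : V → NodeLabel) (half : V → V → EdgeLabel)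
    (out : V → Option BadGraphProof) (u : V) : Prop where
  error : out u = some .error →
    (∃ v, G.Adj u v ∧ (half u v).type ≠ (half v u).type) ∨
    (inp u = .treeNode ∧ ∃ v, G.Adj u v ∧ .gridEdge ∈ (half u v).type)
  treeError : out u = some .treeError →
    ¬ TreeOK (kindGraph G half .treeEdge) (fun a b => (half a b).valT) u
  gridError : out u = some .gridError → inp u ≠ .treeNode ∧
    ¬ VGridOK (kindGraph G half .gridEdge) (fun a b => (half a b).valG)
        (fun v => inp v = .gridNode true) u
  badTree : BadTreeOK (kindGraph G half .treeEdge) (fun a b => (half a b).valT)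
    (fun v => IsMark (out v)) (fun v => toBadTree (out v)) u
  vertError : out u = some .vertError →
    (∀ v, (kindGraph G half .treeEdge).Adj u v → out v = some .vertError) ∧
    inp u ≠ .gridNode true

/-- Reading a `Π` output as a `badGraph` output. -/
def PiOutput.toBadGraph : PiOutput → Option BadGraphProof
  | .bad o => some o
  | .grid _ _ => none
  | .tree _ => none

/-- The component in `{yes, no}` of an output, if there is one. -/
def PiOutput.happy : PiOutput → Option Bool
  | .bad _ => none
  | .grid _ x => some x
  | .tree x => some x

/-- The constraints `C^Π` at the node `u`.  The input of a node is a pair consisting of its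
`badGraph` input and a bit. -/
structure PiOK (G : SimpleGraph V) (inp : V → NodeLabel × Bool) (half : V → V → EdgeLabel)
    (out : V → PiOutput) (u : V) : Prop where
  badGraph : BadGraphOK G (fun v => (inp v).1) half (fun v => (out v).toBadGraph) u
  gridNode : ∀ l, (inp u).1 = .gridNode l → (∃ o, out u = .bad o) ∨ ∃ b x, out u = .grid b x
  row : ∀ b x, out u = .grid b x → ∀ v, Leads G half u [.gridR] v →
    (∃ o, out v = .bad o) ∨ ∃ x', out v = .grid b x'
  rowEnd : ∀ b x, out u = .grid b x → (¬ ∃ v, Leads G half u [.gridR] v) →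
    (x = true ↔ (inp u).2 = b)
  treeNode : (inp u).1 = .treeNode → (∃ o, out u = .bad o) ∨ ∃ x, out u = .tree x
  /-- Every existing child has an output with a `{yes, no}` component, and `u` outputs `yes` if
  and only if the component of at least one child is `yes`. -/
  children : ∀ x, out u = .tree x →
    (∀ v, Leads G half u [.tree .ChL] v ∨ Leads G half u [.tree .ChR] v →
      ∃ y, (out v).happy = some y) ∧
    (x = true ↔ ∃ v, (Leads G half u [.tree .ChL] v ∨ Leads G half u [.tree .ChR] v) ∧
      (out v).happy = some true)
  root : ∀ x, out u = .tree x → (¬ ∃ v, Leads G half u [.tree .P] v) → x = true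

/-- `out` is a valid solution of `Π` on the input-labelled graph `(G, inp, half)`. -/
def PiValid (G : SimpleGraph V) (inp : V → NodeLabel × Bool) (half : V → V → EdgeLabel)
    (out : V → PiOutput) : Prop :=
  ∀ u, PiOK G inp half out u

end Constraints

end PiProblem

/-! ### The randomized SLOCAL model with private randomness -/

universe u

namespace SLOCAL

/-- A network on `n` nodes: a graph, input labels on nodes and half-edges, and identifiers. -/
structure Network (n : ℕ) (VI EI : Type) where
  graph : SimpleGraph (Fin n)
  nodeInput : Fin n → VI
  halfInput : Fin n → Fin n → EI
  ident : Fin n → ℕ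
  ident_injective : Function.Injective ident

/-- The input-labelled topology seen by a node that is being processed.  Nodes are known by their
identifiers. -/
structure View (VI EI : Type) where
  /-- the total number of nodes of the network -/
  size : ℕ
  /-- the identifier of the node being processed -/
  center : ℕ
  /-- identifier and input of each visible node -/
  nodes : Set (ℕ × VI)
  /-- `(a, b, ℓ)`: the visible node `a` has an edge to the node `b`, labelled `ℓ` at `a` -/
  halfEdges : Set (ℕ × ℕ × EI)

section

variable {n : ℕ} {VI EI : Type}

/-- The radius-`T` ball around `v`. -/
def Network.ball (N : Network n VI EI) (T : ℕ) (v : Fin n) : Set (Fin n) :=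
  {w | N.graph.edist v w ≤ (T : ℕ∞)}

/-- What `v` sees of the input: the nodes within distance `T` with their inputs and all their
incident half-edges. -/
def Network.view (N : Network n VI EI) (T : ℕ) (v : Fin n) : View VI EI where
  size := n
  center := N.ident v
  nodes := {p | ∃ w ∈ N.ball T v, p = (N.ident w, N.nodeInput w)}
  halfEdges := {p | ∃ w ∈ N.ball T v, ∃ z, N.graph.Adj w z ∧
    p = (N.ident w, N.ident z, N.halfInput w z)}

end

/-- A randomized SLOCAL algorithm.  The memory of a node is an element of `State`, initially
`init`.  When a node is processed, its new memory is computed by `step` from the view of the node,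
the memory contents of the visible nodes (indexed by identifiers), and the node's private infinite
sequence of random bits.  The output of a node is part of its memory. -/
structure RandAlgorithm (VI EI VO : Type) where
  State : Type u
  [measurableSpace : MeasurableSpace State]
  init : State
  step : View VI EI → (ℕ → State) → (ℕ → Bool) → State
  output : State → VO
  measurable_step : ∀ view : View VI EI,
    Measurable fun p : (ℕ → State) × (ℕ → Bool) => step view p.1 p.2
  measurable_output : ∀ o, MeasurableSet (output ⁻¹' {o})

section

variable {n : ℕ} {VI EI VO : Type}

open Classical in
/-- Processing the node `v`, with random bits `r`, when the current memory of the node with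
identifier `a` is `mem a`.  Only memory within distance `T` of `v` is read and only the memory of
`v` is written. -/
noncomputable def RandAlgorithm.process (A : RandAlgorithm.{u} VI EI VO) (N : Network n VI EI)
    (T : ℕ) (v : Fin n) (r : ℕ → Bool) (mem : ℕ → A.State) : ℕ → A.State :=
  Function.update mem (N.ident v)
    (A.step (N.view T v) (fun a => if a ∈ N.ident '' N.ball T v then mem a else A.init) r)

/-- The memory of all nodes after processing them in the order `σ 0, σ 1, …, σ (n - 1)`; the random
bits of the node `v` are `r v`. -/
noncomputable def RandAlgorithm.finalMemory (A : RandAlgorithm.{u} VI EI VO) (N : Network n VI EI)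
    (T : ℕ) (σ : Equiv.Perm (Fin n)) (r : Fin n → ℕ → Bool) : ℕ → A.State :=
  (List.ofFn σ).foldl (fun mem v => A.process N T v (r v) mem) (fun _ => A.init)

/-- The output labelling. -/
noncomputable def RandAlgorithm.run (A : RandAlgorithm.{u} VI EI VO) (N : Network n VI EI)
    (T : ℕ) (σ : Equiv.Perm (Fin n)) (r : Fin n → ℕ → Bool) (v : Fin n) : VO :=
  A.output (A.finalMemory N T σ r (N.ident v))

end

/-- A fair coin. -/
noncomputable def fairCoin : MeasureTheory.Measure Bool :=
  (PMF.uniformOfFintype Bool).toMeasure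

instance : MeasureTheory.IsProbabilityMeasure fairCoin := by
  unfold fairCoin; infer_instance

/-- Independent infinite sequences of independent fair coin flips, one sequence per node. -/
noncomputable def privateBits (n : ℕ) : MeasureTheory.Measure (Fin n → ℕ → Bool) :=
  MeasureTheory.Measure.pi fun _ => MeasureTheory.Measure.infinitePi fun _ => fairCoin

instance (n : ℕ) : MeasureTheory.IsProbabilityMeasure (privateBits n) := by
  unfold privateBits; infer_instance

/-- `A` solves `Π` with locality `T` on networks with `n` nodes and identifiers in `{1, …, n ^ c}`:
for every such network whose input admits a valid solution at all and for every processing order,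
the output is a valid solution with probability at least `1 - 1 / n`.  Nothing is required of `A`
on inputs without any valid solution. -/
def SolvesPi (A : RandAlgorithm.{u} (PiProblem.NodeLabel × Bool) PiProblem.EdgeLabel
    PiProblem.PiOutput) (c n T : ℕ) : Prop :=
  ∀ N : Network n (PiProblem.NodeLabel × Bool) PiProblem.EdgeLabel,
    (∀ v, N.ident v ∈ Set.Icc 1 (n ^ c)) →
    (∃ out, PiProblem.PiValid N.graph N.nodeInput N.halfInput out) →
    ∀ σ : Equiv.Perm (Fin n),
      1 - 1 / (n : ℝ) ≤ (privateBits n).real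
        {r | PiProblem.PiValid N.graph N.nodeInput N.halfInput (A.run N T σ r)}

end SLOCAL

namespace SLOCAL

/-! The hard instance is a `2 ^ k × 2 ^ k` grid, each of whose columns is the bottom layer of a
perfect binary tree, with `4 ^ k` of order `n` and the remaining nodes isolated. The structure is
locally correct, so no error can be reported (`not_bad`): errors and pointer chains have no legal
origin, and `VertError` would flood a whole column and reach its diagonal leaf, where it is
forbidden. Hence every row carries one common bit (`row_constant`), and the root of the last column
forces some row `i` to output the input bit `β i` of its last node (`exists_row_eq`).

Suppose the locality is too small to get from the first column to the last. The leaves of the first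
column are processed first, so they cannot know `β`; those of the last column come next and see
nothing written by the first. The two ends of a row therefore use disjoint private random bits and
are independent (`privateBits_inter`), yet they must agree with probability at least `1 - 1/n`.
Independent variables that agree this often are almost constant: with `p`, `q` the probabilities of
the two bits at the two ends, agreement has probability at most `∑ p_b q_b ≤ max p_b`. So each row
has a preferred bit `g i`, output at its first node with probability at least `1 - 1/n` and
independent of `β` (`SolvesPi.exists_rowBit`).

The adversary now sets `β i` to the negation of `g i`. A valid run needs some row to deviate from
its preferred bit, which by a union bound has probability at most `2 ^ k / n`. This is far below `1
- 1/n`, a contradiction (`SolvesPi.two_pow_le`). -/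

instance {VI EI VO : Type} (A : RandAlgorithm.{u} VI EI VO) : MeasurableSpace A.State :=
  A.measurableSpace

/-! ### Locality and measurability of SLOCAL runs -/

section Locality

variable {n : ℕ} {VI EI VO : Type}

open Classical in
theorem RandAlgorithm.process_ident (A : RandAlgorithm.{u} VI EI VO) (N : Network n VI EI) (T : ℕ)
    (v : Fin n) (r : ℕ → Bool) (mem : ℕ → A.State) :
    A.process N T v r mem (N.ident v) =
      A.step (N.view T v) (fun a => if a ∈ N.ident '' N.ball T v then mem a else A.init) r :=
  Function.update_self ..

theorem RandAlgorithm.process_of_ne (A : RandAlgorithm.{u} VI EI VO) (N : Network n VI EI) (T : ℕ)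
    {v : Fin n} (r : ℕ → Bool) (mem : ℕ → A.State) {a : ℕ} (ha : a ≠ N.ident v) :
    A.process N T v r mem a = mem a :=
  Function.update_of_ne ha ..

theorem RandAlgorithm.foldl_process_of_notMem (A : RandAlgorithm.{u} VI EI VO)
    (N : Network n VI EI) (T : ℕ) (r : Fin n → ℕ → Bool) (l : List (Fin n)) {w : Fin n}
    (hw : w ∉ l) :
    l.foldl (fun mem v => A.process N T v (r v) mem) (fun _ => A.init) (N.ident w) = A.init := by
  induction l using List.reverseRecOn with
  | nil => rfl
  | append_singleton l v ih =>
    simp only [List.mem_append, List.mem_singleton, not_or] at hw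
    rw [List.foldl_append, List.foldl_cons, List.foldl_nil,
      A.process_of_ne N T _ _ (fun h => hw.2 (N.ident_injective h)), ih hw.1]

/-- The memory of a set `B` of nodes depends only on the views and random bits of `B` if every
node that is seen by a node of `B` and processed before it lies in `B`. -/
theorem RandAlgorithm.foldl_process_congr (A : RandAlgorithm.{u} VI EI VO)
    (N N' : Network n VI EI) (T : ℕ) (B : Set (Fin n)) (hid : N'.ident = N.ident)
    (hview : ∀ v ∈ B, N'.view T v = N.view T v) (hball : ∀ v ∈ B, N'.ball T v = N.ball T v)
    (r r' : Fin n → ℕ → Bool) (hr : ∀ v ∈ B, r v = r' v) (l : List (Fin n))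
    (hl : l.Pairwise fun w v => v ∈ B → w ∈ N.ball T v → w ∈ B) :
    ∀ v ∈ B, l.foldl (fun mem v => A.process N T v (r v) mem) (fun _ => A.init) (N.ident v) =
      l.foldl (fun mem v => A.process N' T v (r' v) mem) (fun _ => A.init) (N.ident v) := by
  induction l using List.reverseRecOn with
  | nil => intros; rfl
  | append_singleton l v ih =>
    rw [List.pairwise_append] at hl
    obtain ⟨hl, -, hlv⟩ := hl
    intro u hu
    simp only [List.foldl_append, List.foldl_cons, List.foldl_nil]
    by_cases huv : u = v
    · subst huv
      rw [A.process_ident, ← hid, A.process_ident, hid, hview u hu, hball u hu, hr u hu]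
      congr 1
      funext a
      by_cases ha : a ∈ N.ident '' N.ball T u
      · rw [if_pos ha, if_pos ha]
        obtain ⟨w, hw, rfl⟩ := ha
        -- A visible node outside `B` cannot have been processed yet, so in both runs its memory is
        -- still `init`.
        by_cases hwB : w ∈ B
        · exact ih hl w hwB
        · have hwl : w ∉ l := fun h => hwB (hlv w h u (List.mem_singleton_self u) hu hw)
          rw [A.foldl_process_of_notMem N T r l hwl]
          have := A.foldl_process_of_notMem N' T r' l hwl
          rw [hid] at this
          exact this.symm
      · rw [if_neg ha, if_neg ha]
    · have hne : N.ident u ≠ N.ident v := fun h => huv (N.ident_injective h)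
      rw [A.process_of_ne N T _ _ hne, A.process_of_ne N' T _ _ (hid ▸ hne)]
      exact ih hl u hu

/-- This form serves two purposes: with different networks it shows that outputs ignore unseen
inputs, and with one network and two random sources it shows on which bits the outputs depend. -/
theorem RandAlgorithm.run_congr (A : RandAlgorithm.{u} VI EI VO)
    (N N' : Network n VI EI) (T : ℕ) (σ : Equiv.Perm (Fin n)) (B : Set (Fin n))
    (hid : N'.ident = N.ident)
    (hview : ∀ v ∈ B, N'.view T v = N.view T v) (hball : ∀ v ∈ B, N'.ball T v = N.ball T v)
    (r r' : Fin n → ℕ → Bool) (hr : ∀ v ∈ B, r v = r' v)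
    (hσ : ∀ i j, i < j → σ j ∈ B → σ i ∈ N.ball T (σ j) → σ i ∈ B) {v : Fin n} (hv : v ∈ B) :
    A.run N T σ r v = A.run N' T σ r' v := by
  rw [RandAlgorithm.run, RandAlgorithm.run, hid]
  refine congrArg _ (A.foldl_process_congr N N' T B hid hview hball r r' hr _ ?_ v hv)
  rw [List.pairwise_ofFn]
  exact fun i j hij => hσ i j hij

-- Each coordinate is either unchanged by a processing step or given by the measurable `step`
-- applied to earlier memory and one private bit sequence. Measurability of output events is needed
-- for independence and for complements.
open Classical in
theorem RandAlgorithm.measurable_foldl_process (A : RandAlgorithm.{u} VI EI VO)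
    (N : Network n VI EI) (T : ℕ) (l : List (Fin n)) :
    Measurable fun r : Fin n → ℕ → Bool =>
      l.foldl (fun mem v => A.process N T v (r v) mem) (fun _ => A.init) := by
  induction l using List.reverseRecOn with
  | nil => exact measurable_const
  | append_singleton l v ih =>
    simp only [List.foldl_append, List.foldl_cons, List.foldl_nil]
    rw [measurable_pi_iff] at ih ⊢
    intro a
    by_cases ha : a = N.ident v
    · subst ha
      have hm : Measurable fun (r : Fin n → ℕ → Bool) (a : ℕ) =>
          if a ∈ N.ident '' N.ball T v then
            l.foldl (fun mem v => A.process N T v (r v) mem) (fun _ => A.init) a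
          else A.init := by
        refine measurable_pi_iff.2 fun a => ?_
        by_cases ha : a ∈ N.ident '' N.ball T v
        · simpa only [if_pos ha] using ih a
        · simpa only [if_neg ha] using measurable_const
      simp only [A.process_ident]
      exact (A.measurable_step (N.view T v)).comp (hm.prodMk (measurable_pi_apply v))
    · simp only [A.process_of_ne N T _ _ ha]
      exact ih a

theorem RandAlgorithm.measurableSet_run_eq (A : RandAlgorithm.{u} VI EI VO)
    (N : Network n VI EI) (T : ℕ) (σ : Equiv.Perm (Fin n)) (v : Fin n) (o : VO) :
    MeasurableSet {r | A.run N T σ r v = o} :=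
  (measurable_pi_iff.1 (A.measurable_foldl_process N T (List.ofFn σ)) (N.ident v))
    (A.measurable_output o)

end Locality

/-! ### Independence of private randomness -/

open MeasureTheory ProbabilityTheory in
/-- Events that depend on the random bits of disjoint sets of nodes are independent. -/
theorem privateBits_inter {n : ℕ} {S S' : Finset (Fin n)} (hS : Disjoint S S')
    {E F : Set (Fin n → ℕ → Bool)} (hE : MeasurableSet E) (hF : MeasurableSet F)
    (hES : ∀ r r', (∀ v ∈ S, r v = r' v) → r ∈ E → r' ∈ E)
    (hFS : ∀ r r', (∀ v ∈ S', r v = r' v) → r ∈ F → r' ∈ F) :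
    (privateBits n).real (E ∩ F) = (privateBits n).real E * (privateBits n).real F := by
  classical
  have hind : iIndepFun (fun (v : Fin n) (r : Fin n → ℕ → Bool) => r v) (privateBits n) :=
    iIndepFun_pi (X := fun _ => id) fun _ => measurable_id.aemeasurable
  have hI := hind.indepFun_finset S S' hS fun v => measurable_pi_apply v
  -- An event that depends only on `S` is the preimage, under restriction to `S`, of a measurable
  -- set: extend by an arbitrary constant sequence outside `S`.
  let glue (S : Finset (Fin n)) (s : S → ℕ → Bool) : Fin n → ℕ → Bool :=
    fun v => if h : v ∈ S then s ⟨v, h⟩ else fun _ => false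
  have hglue (S : Finset (Fin n)) : Measurable (glue S) := by
    refine measurable_pi_iff.2 fun v => ?_
    by_cases h : v ∈ S
    · simpa only [glue, h, dite_true] using measurable_pi_apply _
    · simpa only [glue, h, dite_false] using measurable_const
  have key (S : Finset (Fin n)) (E : Set (Fin n → ℕ → Bool))
      (hES : ∀ r r', (∀ v ∈ S, r v = r' v) → r ∈ E → r' ∈ E) :
      (fun (r : Fin n → ℕ → Bool) (i : S) => r i) ⁻¹' (glue S ⁻¹' E) = E := by
    ext r
    constructor
    · exact hES _ _ fun v hv => by simp [glue, hv]
    · exact hES _ _ fun v hv => by simp [glue, hv]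
  have := hI.measure_inter_preimage_eq_mul _ _ (hglue S hE) (hglue S' hF)
  rw [key S E hES, key S' F hFS] at this
  simp only [Measure.real, this, ENNReal.toReal_mul]

end SLOCAL

namespace PiProblem

/-! ### Walks in deterministically labelled graphs -/

section Traces

variable {V Λ : Type*} {G : SimpleGraph V} {L : V → V → Λ}

theorem Trace.eq_of_deterministic
    (hdet : ∀ u v w, G.Adj u v → G.Adj u w → L u v = L u w → v = w) {ls : List Λ} :
    ∀ {u : V} {vs ws : List V}, Trace G L u ls vs → Trace G L u ls ws → vs = ws := by
  induction ls with
  | nil =>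
    rintro u (_ | ⟨v, vs⟩) (_ | ⟨w, ws⟩) h h' <;> first | rfl | exact h.elim | exact h'.elim
  | cons l ls ih =>
    rintro u (_ | ⟨v, vs⟩) (_ | ⟨w, ws⟩) h h'
    · exact h.elim
    · exact h.elim
    · exact h'.elim
    · obtain ⟨ha, hl, ht⟩ := h
      obtain ⟨ha', hl', ht'⟩ := h'
      obtain rfl := hdet u v w ha ha' (hl.trans hl'.symm)
      rw [ih ht ht']

theorem Leads.of_trace (hdet : ∀ u v w, G.Adj u v → G.Adj u w → L u v = L u w → v = w)
    {u v : V} {ls : List Λ} (vs : List V) (ht : Trace G L u ls vs)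
    (hv : (u :: vs).getLast? = some v) : Leads G L u ls v :=
  ⟨⟨vs, ht, fun _ h => Trace.eq_of_deterministic hdet h ht⟩, vs, ht, hv⟩

theorem Leads.singleton {u v : V} {l : Λ} (h : Leads G L u [l] v) : G.Adj u v ∧ L u v = l := by
  obtain ⟨-, vs, ht, hv⟩ := h
  match vs, ht with
  | [w], ht =>
    simp only [List.getLast?_cons_cons, List.getLast?_singleton, Option.some.injEq] at hv
    subst hv
    exact ⟨ht.1, ht.2.1⟩

theorem leads_singleton_iff (hdet : ∀ u v w, G.Adj u v → G.Adj u w → L u v = L u w → v = w)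
    {u v : V} {l : Λ} : Leads G L u [l] v ↔ G.Adj u v ∧ L u v = l :=
  ⟨Leads.singleton, fun h => Leads.of_trace hdet [v] ⟨h.1, h.2, trivial⟩ rfl⟩

theorem Leads.pair {u v : V} {l l' : Λ} (h : Leads G L u [l, l'] v) :
    ∃ w, (G.Adj u w ∧ L u w = l) ∧ G.Adj w v ∧ L w v = l' := by
  obtain ⟨-, vs, ht, hv⟩ := h
  match vs, ht with
  | [w, z], ht =>
    simp only [List.getLast?_cons_cons, List.getLast?_singleton, Option.some.injEq] at hv
    subst hv
    exact ⟨w, ⟨ht.1, ht.2.1⟩, ht.2.2.1, ht.2.2.2.1⟩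

end Traces

/-! ### A grid whose columns are the bottom layers of perfect binary trees -/

/-- The position of a node: its column, and its level and index in the tree of the column. -/
@[ext] structure Pos where
  col : ℕ
  level : ℕ
  idx : ℕ
  deriving DecidableEq

/-- The positions of the `2 ^ k × 2 ^ k` grid and of the trees on top of its columns. -/
def Pos.Valid (k : ℕ) (p : Pos) : Prop :=
  p.col < 2 ^ k ∧ p.level ≤ k ∧ p.idx < 2 ^ p.level

/-- `q` is the neighbour of `p` in direction `l` of the tree. -/
def TreeStep (k : ℕ) (l : TreeLabel) (p q : Pos) : Prop :=
  p.Valid k ∧ q.Valid k ∧ q.col = p.col ∧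
    match l with
    | .L => q.level = p.level ∧ p.idx = q.idx + 1
    | .R => q.level = p.level ∧ q.idx = p.idx + 1
    | .P => p.level = q.level + 1 ∧ q.idx = p.idx / 2
    | .ChL => q.level = p.level + 1 ∧ q.idx = 2 * p.idx
    | .ChR => q.level = p.level + 1 ∧ q.idx = 2 * p.idx + 1

/-- `q` is the neighbour of `p` in direction `l` of the grid. -/
def GridStep (k : ℕ) (l : GridLabel) (p q : Pos) : Prop :=
  p.Valid k ∧ q.Valid k ∧ p.level = k ∧ q.level = k ∧
    match l with
    | .U => q.col = p.col ∧ q.idx = p.idx + 1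
    | .D => q.col = p.col ∧ p.idx = q.idx + 1
    | .L => p.col = q.col + 1 ∧ q.idx = p.idx
    | .R => q.col = p.col + 1 ∧ q.idx = p.idx

/-- There is an edge from `p` to `q` whose half at `p` is labelled `l`. -/
def Step (k : ℕ) (l : EdgeLabel) (p q : Pos) : Prop :=
  match l with
  -- On the bottom layer the horizontal tree edges are the vertical grid edges and carry the
  -- combined labels, so pure `L` and `R` tree labels occur only above it.
  | .tree l => TreeStep k l p q ∧ (l = .L ∨ l = .R → p.level < k)
  | .gridL => GridStep k .L p q
  | .gridR => GridStep k .R p q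
  | .gridDTreeL => GridStep k .D p q
  | .gridUTreeR => GridStep k .U p q

/-! ### Steps between positions: uniqueness, reversal, tree and grid components -/

section Steps

variable {k : ℕ} {p q q' : Pos}

theorem TreeStep.left_iff : TreeStep k .L p q ↔ TreeStep k .R q p := by
  simp only [TreeStep]; grind

theorem TreeStep.parent_iff : TreeStep k .P p q ↔ TreeStep k .ChL q p ∨ TreeStep k .ChR q p := by
  simp only [TreeStep]; grind

theorem TreeStep.unique {l : TreeLabel} (h : TreeStep k l p q) (h' : TreeStep k l p q') :
    q = q' := by
  cases l <;> simp only [TreeStep] at h h' <;> ext <;> omega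

theorem GridStep.left_iff : GridStep k .L p q ↔ GridStep k .R q p := by
  simp only [GridStep]; grind

theorem GridStep.up_iff : GridStep k .U p q ↔ GridStep k .D q p := by
  simp only [GridStep]; grind

theorem GridStep.unique {l : GridLabel} (h : GridStep k l p q) (h' : GridStep k l p q') :
    q = q' := by
  cases l <;> simp only [GridStep] at h h' <;> ext <;> omega

theorem Step.unique {l : EdgeLabel} (h : Step k l p q) (h' : Step k l p q') : q = q' := by
  cases l with
  | tree l => exact h.1.unique h'.1
  | gridL => exact GridStep.unique (l := .L) h h'
  | gridR => exact GridStep.unique (l := .R) h h'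
  | gridDTreeL => exact GridStep.unique (l := .D) h h'
  | gridUTreeR => exact GridStep.unique (l := .U) h h'

/-- The differences of column, level and index determine the direction, and the level decides
between pure and combined labels. This makes the labelling of half-edges well defined. -/
theorem Step.label_unique {l l' : EdgeLabel} (h : Step k l p q) (h' : Step k l' p q) :
    l = l' := by
  rcases l with (_ | _ | _ | _ | _) | _ | _ | _ | _ <;>
    rcases l' with (_ | _ | _ | _ | _) | _ | _ | _ | _ <;>
    first
      | rfl
      | (exfalso; simp [Step, TreeStep, GridStep] at h h'; omega)

theorem Step.exists_symm {l : EdgeLabel} (h : Step k l p q) :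
    ∃ l', Step k l' q p ∧ l'.type = l.type := by
  match l, h with
  | .tree .L, h =>
    exact ⟨.tree .R, ⟨TreeStep.left_iff.1 h.1, fun _ => by grind [TreeStep, Step]⟩, rfl⟩
  | .tree .R, h =>
    exact ⟨.tree .L, ⟨TreeStep.left_iff.2 h.1, fun _ => by grind [TreeStep, Step]⟩, rfl⟩
  | .tree .P, h =>
    obtain h | h := TreeStep.parent_iff.1 h.1
    · exact ⟨.tree .ChL, ⟨h, by simp⟩, rfl⟩
    · exact ⟨.tree .ChR, ⟨h, by simp⟩, rfl⟩
  | .tree .ChL, h => exact ⟨.tree .P, ⟨TreeStep.parent_iff.2 (.inl h.1), by simp⟩, rfl⟩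
  | .tree .ChR, h => exact ⟨.tree .P, ⟨TreeStep.parent_iff.2 (.inr h.1), by simp⟩, rfl⟩
  | .gridL, h => exact ⟨.gridR, GridStep.left_iff.1 h, rfl⟩
  | .gridR, h => exact ⟨.gridL, GridStep.left_iff.2 h, rfl⟩
  | .gridDTreeL, h => exact ⟨.gridUTreeR, GridStep.up_iff.2 h, rfl⟩
  | .gridUTreeR, h => exact ⟨.gridDTreeL, GridStep.up_iff.1 h, rfl⟩

theorem Step.col_le {l : EdgeLabel} (h : Step k l p q) : q.col ≤ p.col + 1 := by
  rcases l with (_ | _ | _ | _ | _) | _ | _ | _ | _ <;>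
    simp [Step, TreeStep, GridStep] at h <;> omega

theorem Step.gridStep {l : EdgeLabel} {g : GridLabel} (h : Step k l p q) (hl : l.valG = some g) :
    GridStep k g p q := by
  rcases l with _ | _ | _ | _ | _ <;> cases hl <;> exact h

theorem Step.treeStep {l : EdgeLabel} {t : TreeLabel} (h : Step k l p q) (hl : l.valT = some t) :
    TreeStep k t p q := by
  rcases l with _ | _ | _ | _ | _ <;> cases hl
  · exact h.1
  · simp only [Step, TreeStep, GridStep] at h ⊢; grind
  · simp only [Step, TreeStep, GridStep] at h ⊢; grind

theorem GridStep.exists_step {g : GridLabel} (h : GridStep k g p q) :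
    ∃ l, Step k l p q ∧ l.valG = some g := by
  cases g
  exacts [⟨.gridUTreeR, h, rfl⟩, ⟨.gridDTreeL, h, rfl⟩, ⟨.gridL, h, rfl⟩, ⟨.gridR, h, rfl⟩]

theorem TreeStep.exists_step {t : TreeLabel} (h : TreeStep k t p q) :
    ∃ l, Step k l p q ∧ l.valT = some t := by
  by_cases ht : t = .L ∨ t = .R → p.level < k
  · exact ⟨.tree t, ⟨h, ht⟩, rfl⟩
  · push Not at ht
    have hk : p.level = k := le_antisymm h.1.2.1 ht.2
    obtain rfl | rfl := ht.1
    · exact ⟨.gridDTreeL, by simp only [Step, TreeStep, GridStep] at h ⊢; grind, rfl⟩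
    · exact ⟨.gridUTreeR, by simp only [Step, TreeStep, GridStep] at h ⊢; grind, rfl⟩

end Steps

theorem EdgeLabel.exists_valT {l : EdgeLabel} (h : .treeEdge ∈ l.type) : ∃ t, l.valT = some t := by
  cases l <;> simp_all [EdgeLabel.type, EdgeLabel.valT]

theorem EdgeLabel.exists_valG {l : EdgeLabel} (h : .gridEdge ∈ l.type) : ∃ t, l.valG = some t := by
  cases l <;> simp_all [EdgeLabel.type, EdgeLabel.valG]

theorem EdgeLabel.treeEdge_mem_type {l : EdgeLabel} {t : TreeLabel} (h : l.valT = some t) :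
    .treeEdge ∈ l.type := by
  cases l <;> simp_all [EdgeLabel.type, EdgeLabel.valT]

theorem EdgeLabel.gridEdge_mem_type {l : EdgeLabel} {t : GridLabel} (h : l.valG = some t) :
    .gridEdge ∈ l.type := by
  cases l <;> simp_all [EdgeLabel.type, EdgeLabel.valG]

/-! ### The instance as a labelled graph on an abstract node set -/

section Layout

variable {X : Type*}

/-- The nodes in `X` have distinct positions and occupy all valid positions.  Nodes at positions
that are not valid are isolated. -/
structure IsLayout (k : ℕ) (co : X → Pos) : Prop where
  injective : Function.Injective co
  exists_eq : ∀ p, p.Valid k → ∃ x, co x = p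

/-- The grid with trees on top of its columns. -/
def treeGrid (k : ℕ) (co : X → Pos) : SimpleGraph X where
  Adj u v := ∃ l, Step k l (co u) (co v)
  symm := ⟨fun _ _ ⟨_, h⟩ => let ⟨l', h', _⟩ := h.exists_symm; ⟨l', h'⟩⟩
  loopless := ⟨fun u ⟨l, h⟩ => by
    rcases l with (_ | _ | _ | _ | _) | _ | _ | _ | _ <;>
      simp [Step, TreeStep, GridStep] at h⟩

open Classical in
/-- The half-edge labels of `treeGrid`. -/
noncomputable def treeGridHalf (k : ℕ) (co : X → Pos) (u v : X) : EdgeLabel :=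
  if h : ∃ l, Step k l (co u) (co v) then h.choose else .gridL

variable {k : ℕ} {co : X → Pos}

theorem treeGridHalf_eq {u v : X} {l : EdgeLabel} (h : Step k l (co u) (co v)) :
    treeGridHalf k co u v = l := by
  have h' : ∃ l, Step k l (co u) (co v) := ⟨l, h⟩
  rw [treeGridHalf, dif_pos h']
  exact h'.choose_spec.label_unique h

theorem treeGrid_adj_and_half {u v : X} {l : EdgeLabel} :
    (treeGrid k co).Adj u v ∧ treeGridHalf k co u v = l ↔ Step k l (co u) (co v) := by
  constructor
  · rintro ⟨⟨l', h⟩, hl⟩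
    rw [treeGridHalf_eq h] at hl
    exact hl ▸ h
  · exact fun h => ⟨⟨l, h⟩, treeGridHalf_eq h⟩

theorem treeGridHalf_type {u v : X} (h : (treeGrid k co).Adj u v) :
    (treeGridHalf k co u v).type = (treeGridHalf k co v u).type := by
  obtain ⟨l, h⟩ := h
  obtain ⟨l', h', ht⟩ := h.exists_symm
  rw [treeGridHalf_eq h, treeGridHalf_eq h', ht]

/-- The part of `treeGrid` formed by the tree edges. -/
noncomputable abbrev treePart (k : ℕ) (co : X → Pos) : SimpleGraph X :=
  kindGraph (treeGrid k co) (treeGridHalf k co) .treeEdge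

/-- The part of `treeGrid` formed by the grid edges. -/
noncomputable abbrev gridPart (k : ℕ) (co : X → Pos) : SimpleGraph X :=
  kindGraph (treeGrid k co) (treeGridHalf k co) .gridEdge

/-- The half-edge labels of `treePart`. -/
noncomputable abbrev treePartHalf (k : ℕ) (co : X → Pos) (u v : X) : Option TreeLabel :=
  (treeGridHalf k co u v).valT

/-- The half-edge labels of `gridPart`. -/
noncomputable abbrev gridPartHalf (k : ℕ) (co : X → Pos) (u v : X) : Option GridLabel :=
  (treeGridHalf k co u v).valG

theorem treePart_adj_and_half {u v : X} {t : TreeLabel} :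
    (treePart k co).Adj u v ∧ treePartHalf k co u v = some t ↔ TreeStep k t (co u) (co v) := by
  constructor
  · rintro ⟨⟨h, -, -⟩, ht⟩
    exact (treeGrid_adj_and_half.1 ⟨h, rfl⟩).treeStep ht
  · intro h
    obtain ⟨l, hl, ht⟩ := h.exists_step
    have hh := treeGridHalf_eq hl
    exact ⟨⟨⟨l, hl⟩, treeGridHalf_type ⟨l, hl⟩, hh ▸ EdgeLabel.treeEdge_mem_type ht⟩,
      (congrArg _ hh).trans ht⟩

theorem gridPart_adj_and_half {u v : X} {t : GridLabel} :
    (gridPart k co).Adj u v ∧ gridPartHalf k co u v = some t ↔ GridStep k t (co u) (co v) := by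
  constructor
  · rintro ⟨⟨h, -, -⟩, ht⟩
    exact (treeGrid_adj_and_half.1 ⟨h, rfl⟩).gridStep ht
  · intro h
    obtain ⟨l, hl, ht⟩ := h.exists_step
    have hh := treeGridHalf_eq hl
    exact ⟨⟨⟨l, hl⟩, treeGridHalf_type ⟨l, hl⟩, hh ▸ EdgeLabel.gridEdge_mem_type ht⟩,
      (congrArg _ hh).trans ht⟩

theorem exists_treeStep {u v : X} (h : (treePart k co).Adj u v) :
    ∃ t, TreeStep k t (co u) (co v) := by
  obtain ⟨t, ht⟩ := EdgeLabel.exists_valT h.2.2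
  exact ⟨t, treePart_adj_and_half.1 ⟨h, ht⟩⟩

theorem IsLayout.treeGrid_deterministic (hco : IsLayout k co) (u v w : X)
    (hv : (treeGrid k co).Adj u v) (hw : (treeGrid k co).Adj u w)
    (h : treeGridHalf k co u v = treeGridHalf k co u w) : v = w :=
  hco.injective ((treeGrid_adj_and_half.1 ⟨hv, h⟩).unique (treeGrid_adj_and_half.1 ⟨hw, rfl⟩))

theorem IsLayout.treePart_deterministic (hco : IsLayout k co) (u v w : X)
    (hv : (treePart k co).Adj u v) (hw : (treePart k co).Adj u w)
    (h : treePartHalf k co u v = treePartHalf k co u w) : v = w := by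
  obtain ⟨t, ht⟩ := EdgeLabel.exists_valT hv.2.2
  exact hco.injective ((treePart_adj_and_half.1 ⟨hv, ht⟩).unique
    (treePart_adj_and_half.1 ⟨hw, h ▸ ht⟩))

theorem IsLayout.gridPart_deterministic (hco : IsLayout k co) (u v w : X)
    (hv : (gridPart k co).Adj u v) (hw : (gridPart k co).Adj u w)
    (h : gridPartHalf k co u v = gridPartHalf k co u w) : v = w := by
  obtain ⟨t, ht⟩ := EdgeLabel.exists_valG hv.2.2
  exact hco.injective ((gridPart_adj_and_half.1 ⟨hv, ht⟩).unique
    (gridPart_adj_and_half.1 ⟨hw, h ▸ ht⟩))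

theorem IsLayout.treeGrid_leads (hco : IsLayout k co) {u v : X} {l : EdgeLabel} :
    Leads (treeGrid k co) (treeGridHalf k co) u [l] v ↔ Step k l (co u) (co v) :=
  (leads_singleton_iff hco.treeGrid_deterministic).trans treeGrid_adj_and_half

theorem IsLayout.treePart_leads (hco : IsLayout k co) {u v : X} {l : TreeLabel} :
    Leads (treePart k co) (treePartHalf k co) u [some l] v ↔ TreeStep k l (co u) (co v) :=
  (leads_singleton_iff hco.treePart_deterministic).trans treePart_adj_and_half

theorem IsLayout.gridPart_leads (hco : IsLayout k co) {u v : X} {l : GridLabel} :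
    Leads (gridPart k co) (gridPartHalf k co) u [some l] v ↔ GridStep k l (co u) (co v) :=
  (leads_singleton_iff hco.gridPart_deterministic).trans gridPart_adj_and_half

theorem treePart_has_iff {u : X} {l : TreeLabel} :
    Has (treePart k co) (treePartHalf k co) u (some l) ↔ ∃ v, TreeStep k l (co u) (co v) :=
  exists_congr fun _ => treePart_adj_and_half

theorem gridPart_has_iff {u : X} {l : GridLabel} :
    Has (gridPart k co) (gridPartHalf k co) u (some l) ↔ ∃ v, GridStep k l (co u) (co v) :=
  exists_congr fun _ => gridPart_adj_and_half

/-- Every valid position is occupied, so existence of neighbours becomes arithmetic on positions. -/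
theorem IsLayout.exists_comp_iff (hco : IsLayout k co) {Q : Pos → Prop}
    (hQ : ∀ p, Q p → p.Valid k) : (∃ v, Q (co v)) ↔ ∃ p, Q p :=
  ⟨fun ⟨v, h⟩ => ⟨co v, h⟩, fun ⟨p, h⟩ => by
    obtain ⟨v, rfl⟩ := hco.exists_eq p (hQ p h); exact ⟨v, h⟩⟩

theorem IsLayout.treePart_has (hco : IsLayout k co) {u : X} {l : TreeLabel} :
    Has (treePart k co) (treePartHalf k co) u (some l) ↔ ∃ q, TreeStep k l (co u) q :=
  treePart_has_iff.trans (hco.exists_comp_iff fun _ h => h.2.1)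

theorem IsLayout.gridPart_has (hco : IsLayout k co) {u : X} {l : GridLabel} :
    Has (gridPart k co) (gridPartHalf k co) u (some l) ↔ ∃ q, GridStep k l (co u) q :=
  gridPart_has_iff.trans (hco.exists_comp_iff fun _ h => h.2.1)

end Layout

/-! ### Which neighbours a position has -/

section Neighbours

variable {k : ℕ} {p : Pos}

theorem Pos.Valid.idx_half (h : p.Valid k) {j : ℕ} (hj : p.level = j + 1) :
    p.idx / 2 < 2 ^ j := by
  have := h.2.2
  rw [hj, pow_succ] at this
  omega

theorem exists_treeStep_left : (∃ q, TreeStep k .L p q) ↔ p.Valid k ∧ p.idx ≠ 0 := by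
  constructor
  · rintro ⟨q, h⟩
    exact ⟨h.1, by simp only [TreeStep] at h; omega⟩
  · rintro ⟨h, h0⟩
    refine ⟨⟨p.col, p.level, p.idx - 1⟩, h, ⟨h.1, h.2.1, ?_⟩, rfl, rfl, by simp; omega⟩
    have := h.2.2
    simp only
    omega

theorem exists_treeStep_right :
    (∃ q, TreeStep k .R p q) ↔ p.Valid k ∧ p.idx + 1 < 2 ^ p.level := by
  constructor
  · rintro ⟨q, h⟩
    refine ⟨h.1, ?_⟩
    have := h.2.1.2.2
    simp only [TreeStep] at h
    rw [h.2.2.2.1] at this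
    omega
  · rintro ⟨h, h0⟩
    exact ⟨⟨p.col, p.level, p.idx + 1⟩, h, ⟨h.1, h.2.1, h0⟩, rfl, rfl, rfl⟩

theorem exists_treeStep_parent : (∃ q, TreeStep k .P p q) ↔ p.Valid k ∧ p.level ≠ 0 := by
  constructor
  · rintro ⟨q, h⟩
    exact ⟨h.1, by simp only [TreeStep] at h; omega⟩
  · rintro ⟨h, h0⟩
    obtain ⟨j, hj⟩ := Nat.exists_eq_succ_of_ne_zero h0
    exact ⟨⟨p.col, j, p.idx / 2⟩, h, ⟨h.1, by have := h.2.1; simp only; omega, h.idx_half hj⟩,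
      rfl, hj, rfl⟩

theorem exists_treeStep_childLeft : (∃ q, TreeStep k .ChL p q) ↔ p.Valid k ∧ p.level < k := by
  constructor
  · rintro ⟨q, h⟩
    refine ⟨h.1, ?_⟩
    have := h.2.1.2.1
    simp only [TreeStep] at h
    omega
  · rintro ⟨h, h0⟩
    refine ⟨⟨p.col, p.level + 1, 2 * p.idx⟩, h, ⟨h.1, h0, ?_⟩, rfl, rfl, rfl⟩
    have := h.2.2
    simp only [pow_succ]
    omega

theorem exists_treeStep_childRight : (∃ q, TreeStep k .ChR p q) ↔ p.Valid k ∧ p.level < k := by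
  constructor
  · rintro ⟨q, h⟩
    refine ⟨h.1, ?_⟩
    have := h.2.1.2.1
    simp only [TreeStep] at h
    omega
  · rintro ⟨h, h0⟩
    refine ⟨⟨p.col, p.level + 1, 2 * p.idx + 1⟩, h, ⟨h.1, h0, ?_⟩, rfl, rfl, rfl⟩
    have := h.2.2
    simp only [pow_succ]
    omega

theorem exists_gridStep_left :
    (∃ q, GridStep k .L p q) ↔ p.Valid k ∧ p.level = k ∧ p.col ≠ 0 := by
  constructor
  · rintro ⟨q, h⟩
    exact ⟨h.1, h.2.2.1, by simp only [GridStep] at h; omega⟩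
  · rintro ⟨h, hk, h0⟩
    refine ⟨⟨p.col - 1, p.level, p.idx⟩, h, ⟨?_, h.2⟩, hk, hk, by simp; omega, rfl⟩
    have := h.1
    simp only
    omega

theorem exists_gridStep_right :
    (∃ q, GridStep k .R p q) ↔ p.Valid k ∧ p.level = k ∧ p.col + 1 < 2 ^ k := by
  constructor
  · rintro ⟨q, h⟩
    refine ⟨h.1, h.2.2.1, ?_⟩
    have := h.2.1.1
    simp only [GridStep] at h
    omega
  · rintro ⟨h, hk, h0⟩
    exact ⟨⟨p.col + 1, p.level, p.idx⟩, h, ⟨h0, h.2⟩, hk, hk, rfl, rfl⟩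

theorem exists_gridStep_up :
    (∃ q, GridStep k .U p q) ↔ p.Valid k ∧ p.level = k ∧ p.idx + 1 < 2 ^ k := by
  constructor
  · rintro ⟨q, h⟩
    refine ⟨h.1, h.2.2.1, ?_⟩
    have := h.2.1.2.2
    rw [h.2.2.2.1] at this
    simp only [GridStep] at h
    omega
  · rintro ⟨h, hk, h0⟩
    exact ⟨⟨p.col, p.level, p.idx + 1⟩, h, ⟨h.1, h.2.1, hk ▸ h0⟩, hk, hk, rfl, rfl⟩

theorem exists_gridStep_down :
    (∃ q, GridStep k .D p q) ↔ p.Valid k ∧ p.level = k ∧ p.idx ≠ 0 := by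
  constructor
  · rintro ⟨q, h⟩
    exact ⟨h.1, h.2.2.1, by simp only [GridStep] at h; omega⟩
  · rintro ⟨h, hk, h0⟩
    refine ⟨⟨p.col, p.level, p.idx - 1⟩, h, ⟨h.1, h.2.1, ?_⟩, hk, hk, rfl, by simp; omega⟩
    have := h.2.2
    simp only
    omega

end Neighbours

end PiProblem

namespace PiProblem

/-! ### The instance satisfies the tree and grid constraints -/

section Constraints

variable {X : Type*} {k : ℕ} {co : X → Pos}

theorem treePartHalf_eq_some {u v : X} (h : (treePart k co).Adj u v) {t : TreeLabel} :
    treePartHalf k co u v = some t ↔ TreeStep k t (co u) (co v) :=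
  ⟨fun ht => treePart_adj_and_half.1 ⟨h, ht⟩, fun ht => (treePart_adj_and_half.2 ht).2⟩

theorem gridPartHalf_eq_some {u v : X} (h : (gridPart k co).Adj u v) {t : GridLabel} :
    gridPartHalf k co u v = some t ↔ GridStep k t (co u) (co v) :=
  ⟨fun ht => gridPart_adj_and_half.1 ⟨h, ht⟩, fun ht => (gridPart_adj_and_half.2 ht).2⟩

theorem IsLayout.treePart_triangle (hco : IsLayout k co) {u v : X}
    (h : TreeStep k .P (co u) (co v)) (h' : TreeStep k .ChL (co v) (co u)) :
    Leads (treePart k co) (treePartHalf k co) u [some .P, some .ChR, some .L] u := by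
  obtain ⟨q, hq⟩ := exists_treeStep_childRight.2
    ⟨h'.1, exists_treeStep_childLeft.1 ⟨_, h'⟩ |>.2⟩
  obtain ⟨s, rfl⟩ := hco.exists_eq q hq.2.1
  have hs : TreeStep k .L (co s) (co u) := ⟨hq.2.1, h.1, by
    simp only [TreeStep] at h' hq; omega⟩
  have e1 := treePart_adj_and_half.2 h
  have e2 := treePart_adj_and_half.2 hq
  have e3 := treePart_adj_and_half.2 hs
  exact Leads.of_trace hco.treePart_deterministic [v, s, u]
    ⟨e1.1, e1.2, e2.1, e2.2, e3.1, e3.2, trivial⟩ rfl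

/-- The right child `2i + 1` is last among `2 ^ (j + 1)` nodes exactly when `i` is last among `2 ^
j`. -/
theorem TreeStep.right_iff_of_childRight {p q : Pos} (h : TreeStep k .ChR q p) :
    (∃ p', TreeStep k .R p p') ↔ ∃ q', TreeStep k .R q q' := by
  rw [exists_treeStep_right, exists_treeStep_right, and_iff_right h.1, and_iff_right h.2.1]
  simp only [TreeStep] at h
  rw [h.2.2.2.1, h.2.2.2.2, pow_succ]
  omega

theorem TreeStep.left_iff_of_childLeft {p q : Pos} (h : TreeStep k .ChL q p) :
    (∃ p', TreeStep k .L p p') ↔ ∃ q', TreeStep k .L q q' := by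
  rw [exists_treeStep_left, exists_treeStep_left, and_iff_right h.1, and_iff_right h.2.1]
  simp only [TreeStep] at h
  omega

/-- If `u` has index `2i + 1`, the right neighbour of its parent has index `i + 1`, whose left child
`2i + 2` is the node just to the right of `u`. -/
theorem IsLayout.treePart_square (hco : IsLayout k co) {u v : X}
    (h : TreeStep k .P (co u) (co v)) (h' : TreeStep k .ChR (co v) (co u))
    (hR : ∃ q, TreeStep k .R (co u) q) :
    Leads (treePart k co) (treePartHalf k co) u [some .P, some .R, some .ChL, some .L] u := by
  obtain ⟨q, hq⟩ := h'.right_iff_of_childRight.1 hR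
  obtain ⟨s, rfl⟩ := hco.exists_eq q hq.2.1
  have hk := exists_treeStep_childRight.1 ⟨_, h'⟩ |>.2
  obtain ⟨q, hq'⟩ := exists_treeStep_childLeft.2
    (⟨hq.2.1, by simp only [TreeStep] at hq; omega⟩ : (co s).Valid k ∧ (co s).level < k)
  obtain ⟨s', rfl⟩ := hco.exists_eq q hq'.2.1
  have hs : TreeStep k .L (co s') (co u) := ⟨hq'.2.1, h.1, by
    simp only [TreeStep] at h' hq hq'; omega⟩
  have e1 := treePart_adj_and_half.2 h
  have e2 := treePart_adj_and_half.2 hq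
  have e3 := treePart_adj_and_half.2 hq'
  have e4 := treePart_adj_and_half.2 hs
  exact Leads.of_trace hco.treePart_deterministic [v, s, s', u]
    ⟨e1.1, e1.2, e2.1, e2.2, e3.1, e3.2, e4.1, e4.2, trivial⟩ rfl

theorem IsLayout.treeOK (hco : IsLayout k co) (u : X) :
    TreeOK (treePart k co) (treePartHalf k co) u where
  distinct v w hv hw hne h := hne (hco.treePart_deterministic u v w hv hw h)
  left_right v hv := by
    simp only [treePartHalf_eq_some hv, treePartHalf_eq_some hv.symm]
    exact ⟨TreeStep.left_iff, TreeStep.left_iff.symm⟩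
  parent_child v hv := by
    simp only [treePartHalf_eq_some hv, treePartHalf_eq_some hv.symm]
    exact ⟨TreeStep.parent_iff, TreeStep.parent_iff⟩
  triangle v hv h h' := hco.treePart_triangle ((treePartHalf_eq_some hv).1 h)
    ((treePartHalf_eq_some hv.symm).1 h')
  square v hv h h' hR := hco.treePart_square ((treePartHalf_eq_some hv).1 h)
    ((treePartHalf_eq_some hv.symm).1 h') (hco.treePart_has.1 hR)
  two_children := by
    rw [hco.treePart_has, hco.treePart_has, exists_treeStep_childLeft, exists_treeStep_childRight]
  root := by
    rw [hco.treePart_has, hco.treePart_has, hco.treePart_has, exists_treeStep_parent,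
      exists_treeStep_left, exists_treeStep_right]
    by_cases h : (co u).Valid k
    · simp only [h, true_and, not_not]
      have hi := h.2.2
      constructor
      · intro h0
        rw [h0] at hi ⊢
        omega
      -- A node that is both first and last is alone on its level, while a level `j + 1` has at
      -- least two nodes.
      · rintro ⟨h0, h1⟩
        by_contra hl
        obtain ⟨j, hj⟩ := Nat.exists_eq_succ_of_ne_zero hl
        rw [h0, hj, pow_succ] at h1
        have := Nat.pow_pos (n := j) (Nat.zero_lt_two)
        omega
    · simp [h]
  boundary_children h _ v hv := by
    rw [hco.treePart_has, exists_treeStep_childLeft] at h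
    rw [hco.treePart_has, hco.treePart_has, exists_treeStep_childLeft, exists_treeStep_childRight,
      and_self]
    rw [hco.treePart_leads, hco.treePart_leads] at hv
    rintro ⟨-, hlt⟩
    obtain hv | hv := hv <;> exact h ⟨hv.1, by simp only [TreeStep] at hv; omega⟩
  boundary_right v hv h h' := by
    rw [treePartHalf_eq_some hv.symm] at h'
    rw [treePartHalf_eq_some hv] at h
    rw [hco.treePart_has, h'.right_iff_of_childRight]
    constructor
    · exact fun h1 => ⟨v, hco.treePart_leads.2 h, hco.treePart_has.2 h1⟩
    · rintro ⟨w, hw, h1⟩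
      rw [hco.treePart_leads] at hw
      rw [hco.treePart_has] at h1
      rwa [h.unique hw]
  boundary_left v hv h h' := by
    rw [treePartHalf_eq_some hv.symm] at h'
    rw [treePartHalf_eq_some hv] at h
    rw [hco.treePart_has, h'.left_iff_of_childLeft]
    constructor
    · exact fun h1 => ⟨v, hco.treePart_leads.2 h, hco.treePart_has.2 h1⟩
    · rintro ⟨w, hw, h1⟩
      rw [hco.treePart_leads] at hw
      rw [hco.treePart_has] at h1
      rwa [h.unique hw]

theorem IsLayout.gridPart_square (hco : IsLayout k co) {u : X}
    (hR : ∃ q, GridStep k .R (co u) q) (hU : ∃ q, GridStep k .U (co u) q) :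
    Leads (gridPart k co) (gridPartHalf k co) u [some .R, some .U, some .L, some .D] u := by
  have hU' := exists_gridStep_up.1 hU
  obtain ⟨q, hq⟩ := hR
  obtain ⟨a, rfl⟩ := hco.exists_eq q hq.2.1
  obtain ⟨q, hb⟩ := hU
  obtain ⟨b, rfl⟩ := hco.exists_eq q hb.2.1
  obtain ⟨q, hc⟩ := exists_gridStep_up.2
    (⟨hq.2.1, hq.2.2.2.1, by simp only [GridStep] at hq; omega⟩ :
      (co a).Valid k ∧ (co a).level = k ∧ (co a).idx + 1 < 2 ^ k)
  obtain ⟨c, rfl⟩ := hco.exists_eq q hc.2.1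
  have hcb : GridStep k .L (co c) (co b) := ⟨hc.2.1, hb.2.1, by
    simp only [GridStep] at hq hb hc; omega⟩
  have e1 := gridPart_adj_and_half.2 hq
  have e2 := gridPart_adj_and_half.2 hc
  have e3 := gridPart_adj_and_half.2 hcb
  have e4 := gridPart_adj_and_half.2 (GridStep.up_iff.1 hb)
  exact Leads.of_trace hco.gridPart_deterministic [a, c, b, u]
    ⟨e1.1, e1.2, e2.1, e2.2, e3.1, e3.2, e4.1, e4.2, trivial⟩ rfl

theorem IsLayout.gridOK (hco : IsLayout k co) (u : X) :
    GridOK (gridPart k co) (gridPartHalf k co) u where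
  distinct v w hv hw hne h := hne (hco.gridPart_deterministic u v w hv hw h)
  left_right v hv := by
    simp only [gridPartHalf_eq_some hv, gridPartHalf_eq_some hv.symm]
    exact ⟨GridStep.left_iff, GridStep.left_iff.symm⟩
  up_down v hv := by
    simp only [gridPartHalf_eq_some hv, gridPartHalf_eq_some hv.symm]
    exact ⟨GridStep.up_iff, GridStep.up_iff.symm⟩
  square hR hU := hco.gridPart_square (hco.gridPart_has.1 hR) (hco.gridPart_has.1 hU)
  down_propagates v hv := by
    rw [hco.gridPart_leads] at hv
    simp only [hco.gridPart_has, exists_gridStep_down, exists_gridStep_up]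
    have h1 := hv.1
    have h2 := hv.2.1
    simp only [GridStep] at hv
    simp only [h1, h2, hv.2.2.1, hv.2.2.2.1, hv.2.2.2.2.2, true_and, and_self]
  left_propagates v hv := by
    rw [hco.gridPart_leads] at hv
    simp only [hco.gridPart_has, exists_gridStep_left, exists_gridStep_right]
    have h1 := hv.1
    have h2 := hv.2.1
    simp only [GridStep] at hv
    simp only [h1, h2, hv.2.2.1, hv.2.2.2.1, hv.2.2.2.2.1, true_and, and_self]

open Classical in
/-- The node inputs: the grid is formed by the bottom layers of the trees, its main diagonal is
labelled `1`, and the nodes of the last column get the bits `β`. -/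
noncomputable def treeGridInput (k : ℕ) (co : X → Pos) (β : ℕ → Bool) (u : X) :
    NodeLabel × Bool :=
  (if (co u).Valid k ∧ (co u).level = k then .gridNode (decide ((co u).idx = (co u).col))
    else .treeNode, if (co u).col + 1 = 2 ^ k then β (co u).idx else false)

variable {β : ℕ → Bool}

theorem treeGridInput_fst_eq_one {u : X} :
    (treeGridInput k co β u).1 = .gridNode true ↔
      (co u).Valid k ∧ (co u).level = k ∧ (co u).idx = (co u).col := by
  by_cases h : (co u).Valid k ∧ (co u).level = k
  · simp [treeGridInput, h]
  · simp only [treeGridInput, h]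
    simp only [if_false, reduceCtorEq, false_iff]
    tauto

theorem treeGridInput_fst_eq_treeNode {u : X} :
    (treeGridInput k co β u).1 = .treeNode ↔ ¬ ((co u).Valid k ∧ (co u).level = k) := by
  by_cases h : (co u).Valid k ∧ (co u).level = k <;> simp [treeGridInput, h]

/-- Diagonal moves preserve `idx = col`. The grid is square, so a diagonal node meets the bottom
border only together with the left one, and the top border only together with the right one. -/
theorem IsLayout.vGridOK (hco : IsLayout k co) (u : X) :
    VGridOK (gridPart k co) (gridPartHalf k co)
      (fun v => (treeGridInput k co β v).1 = .gridNode true) u where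
  grid := hco.gridOK u
  diagonal h v hv := by
    rw [treeGridInput_fst_eq_one] at h ⊢
    obtain hv | hv := hv <;> obtain ⟨w, h1, h2⟩ := hv.pair <;>
      rw [gridPart_adj_and_half] at h1 h2 <;>
      refine ⟨h2.2.1, h2.2.2.2.1, ?_⟩ <;> simp only [GridStep] at h1 h2 <;> omega
  bottom h hD := by
    rw [treeGridInput_fst_eq_one] at h
    simp only [hco.gridPart_leads] at hD ⊢
    rw [hco.exists_comp_iff fun _ h => h.2.1] at hD ⊢
    rw [exists_gridStep_down] at hD
    rw [exists_gridStep_left]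
    rw [← h.2.2]
    exact hD
  top h hU := by
    rw [treeGridInput_fst_eq_one] at h
    simp only [hco.gridPart_leads] at hU ⊢
    rw [hco.exists_comp_iff fun _ h => h.2.1] at hU ⊢
    rw [exists_gridStep_up] at hU
    rw [exists_gridStep_right]
    rw [← h.2.2]
    exact hU

/-! ### A valid solution -/

open Classical in
/-- A valid solution: every row outputs its bit in the last column, and all nodes say `yes`. -/
noncomputable def treeGridSolution (k : ℕ) (co : X → Pos) (β : ℕ → Bool) (u : X) : PiOutput :=
  if (co u).Valid k then if (co u).level = k then .grid (β (co u).idx) true else .tree true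
  else .bad .vertError

theorem treeGridSolution_leaf {u : X} (h : (co u).Valid k) (hk : (co u).level = k) :
    treeGridSolution k co β u = .grid (β (co u).idx) true := by
  simp [treeGridSolution, h, hk]

theorem treeGridSolution_inner {u : X} (h : (co u).Valid k) (hk : (co u).level ≠ k) :
    treeGridSolution k co β u = .tree true := by
  simp [treeGridSolution, h, hk]

theorem treeGridSolution_pad {u : X} (h : ¬ (co u).Valid k) :
    treeGridSolution k co β u = .bad .vertError := by
  simp [treeGridSolution, h]

theorem treeGridSolution_toBadGraph (u : X) :
    (treeGridSolution k co β u).toBadGraph = none ∨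
      ¬ (co u).Valid k ∧ (treeGridSolution k co β u).toBadGraph = some .vertError := by
  by_cases h : (co u).Valid k
  · left
    by_cases hk : (co u).level = k
    · rw [treeGridSolution_leaf h hk]; rfl
    · rw [treeGridSolution_inner h hk]; rfl
  · right
    rw [treeGridSolution_pad h]
    exact ⟨h, rfl⟩

theorem treeGridSolution_happy {u : X} (h : (co u).Valid k) :
    (treeGridSolution k co β u).happy = some true := by
  by_cases hk : (co u).level = k
  · rw [treeGridSolution_leaf h hk]; rfl
  · rw [treeGridSolution_inner h hk]; rfl

theorem badGraphOK_treeGridSolution (u : X) :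
    BadGraphOK (treeGrid k co) (fun v => (treeGridInput k co β v).1) (treeGridHalf k co)
      (fun v => (treeGridSolution k co β v).toBadGraph) u := by
  have hnone : toBadTree (treeGridSolution k co β u).toBadGraph = none := by
    obtain h | ⟨-, h⟩ := treeGridSolution_toBadGraph (β := β) (k := k) (co := co) u <;>
      rw [h] <;> rfl
  have hnone' : ∀ o, o ≠ .vertError → (treeGridSolution k co β u).toBadGraph ≠ some o := by
    intro o ho h'
    obtain h | ⟨-, h⟩ := treeGridSolution_toBadGraph (β := β) (k := k) (co := co) u <;>
      rw [h] at h' <;> cases h'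
    exact ho rfl
  refine ⟨fun h => absurd h (hnone' _ (by simp)), fun h => absurd h (hnone' _ (by simp)),
    fun h => absurd h (hnone' _ (by simp)), ⟨?_, ?_⟩, fun h => ?_⟩
  · intro h
    rw [hnone] at h
    cases h
  · intro p h
    rw [hnone] at h
    cases h
  · obtain h' | ⟨hu, -⟩ := treeGridSolution_toBadGraph (β := β) (k := k) (co := co) u
    · rw [h'] at h
      cases h
    · refine ⟨fun v hv => ?_, fun h1 => hu (treeGridInput_fst_eq_one.1 h1).1⟩
      obtain ⟨t, ht⟩ := exists_treeStep hv
      exact absurd ht.1 hu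

/-- Algorithms are only held to solvable inputs, so the instance must be solvable for every `β`.
Padding nodes may claim `VertError` because they are isolated and not labelled `1`. -/
theorem IsLayout.piValid_treeGridSolution (hco : IsLayout k co) :
    PiValid (treeGrid k co) (treeGridInput k co β) (treeGridHalf k co)
      (treeGridSolution k co β) := by
  intro u
  refine ⟨badGraphOK_treeGridSolution u, ?_, ?_, ?_, ?_, ?_, ?_⟩
  · intro l hl
    right
    by_cases h : (co u).Valid k ∧ (co u).level = k
    · exact ⟨_, _, treeGridSolution_leaf h.1 h.2⟩
    · rw [treeGridInput_fst_eq_treeNode.2 h] at hl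
      cases hl
  · intro b x hu v hv
    rw [hco.treeGrid_leads] at hv
    have hv : GridStep k .R (co u) (co v) := hv
    right
    rw [treeGridSolution_leaf hv.1 hv.2.2.1] at hu
    rw [treeGridSolution_leaf hv.2.1 hv.2.2.2.1, hv.2.2.2.2.2]
    cases hu
    exact ⟨_, rfl⟩
  · intro b x hu hR
    simp only [hco.treeGrid_leads] at hR
    replace hR : ¬ ∃ v, GridStep k .R (co u) (co v) := hR
    rw [hco.exists_comp_iff fun _ h => h.2.1, exists_gridStep_right] at hR
    by_cases h : (co u).Valid k
    · by_cases hk : (co u).level = k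
      · rw [treeGridSolution_leaf h hk] at hu
        cases hu
        have h1 := h.1
        have : (co u).col + 1 = 2 ^ k := by
          by_contra hne
          exact hR ⟨h, hk, by omega⟩
        simp [treeGridInput, this]
      · rw [treeGridSolution_inner h hk] at hu
        cases hu
    · rw [treeGridSolution_pad h] at hu
      cases hu
  · intro h
    by_cases hu : (co u).Valid k
    · exact .inr ⟨_, treeGridSolution_inner hu
        fun hk => treeGridInput_fst_eq_treeNode.1 h ⟨hu, hk⟩⟩
    · exact .inl ⟨_, treeGridSolution_pad hu⟩
  · intro x hx
    have hu : (co u).Valid k ∧ (co u).level < k ∧ x = true := by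
      by_cases hu : (co u).Valid k
      · by_cases hk : (co u).level = k
        · rw [treeGridSolution_leaf hu hk] at hx
          cases hx
        · rw [treeGridSolution_inner hu hk] at hx
          cases hx
          exact ⟨hu, lt_of_le_of_ne hu.2.1 hk, rfl⟩
      · rw [treeGridSolution_pad hu] at hx
        cases hx
    obtain ⟨hu, hk, rfl⟩ := hu
    simp only [hco.treeGrid_leads]
    refine ⟨?_, ?_⟩
    · rintro v (hv | hv) <;> exact ⟨_, treeGridSolution_happy hv.1.2.1⟩
    · refine iff_of_true trivial ?_
      obtain ⟨q, hq⟩ := exists_treeStep_childLeft.2 ⟨hu, hk⟩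
      obtain ⟨v, rfl⟩ := hco.exists_eq q hq.2.1
      exact ⟨v, .inl ⟨hq, by simp⟩, treeGridSolution_happy hq.2.1⟩
  · intro x hx _
    simp only [treeGridSolution] at hx
    split_ifs at hx
    cases hx
    rfl

end Constraints

end PiProblem

namespace PiProblem

/-! ### What every valid solution must look like -/

section Forced

variable {X : Type*} {k : ℕ} {co : X → Pos} {β : ℕ → Bool} {out : X → PiOutput}

/-- There are no chains of pointers that do not end in an error. -/
theorem IsLayout.badTree_eq_none (hco : IsLayout k co) {marked : X → Prop}
    {o : X → Option BadTreeProof}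
    (h : ∀ u, BadTreeOK (treePart k co) (treePartHalf k co) marked o u)
    (herr : ∀ u, o u ≠ some .error) (u : X) : o u = none := by
  have next : ∀ u p, o u = some (.pointer p) → ∃ v p', TreeStep k p.toLabel (co u) (co v) ∧
      o v = some (.pointer p') ∧ p.Compatible p' := by
    intro u p hu
    obtain ⟨v, hv, hv'⟩ := (h u).pointer p hu
    rw [hco.treePart_leads] at hv
    obtain hv' | ⟨p', h1, -, h2⟩ := hv'
    · exact absurd hv' (herr v)
    · exact ⟨v, p', hv, h1, h2⟩
  -- Each direction has a quantity that drops along its chain: the index for `L`, the distance to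
  -- the right end for `R`, the level for `P`, the distance to the bottom for `ChR`. The last two
  -- may turn into `L` or `R`, hence the order of the four claims.
  have hL : ∀ m u, (co u).idx = m → o u ≠ some (.pointer .L) := by
    intro m
    induction m with
    | zero =>
      intro u hm hu
      obtain ⟨v, p', h1, h2, h3⟩ := next u _ hu
      simp only [PointerDir.toLabel, TreeStep] at h1
      omega
    | succ m ih =>
      intro u hm hu
      obtain ⟨v, p', h1, h2, rfl⟩ := next u _ hu
      refine ih v ?_ h2
      simp only [PointerDir.toLabel, TreeStep] at h1
      omega
  have hR : ∀ m u, 2 ^ (co u).level - (co u).idx = m → o u ≠ some (.pointer .R) := by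
    intro m
    induction m using Nat.strong_induction_on with
    | _ m ih =>
      intro u hm hu
      obtain ⟨v, p', h1, h2, rfl⟩ := next u _ hu
      refine ih _ ?_ v rfl h2
      have := h1.1.2.2
      simp only [PointerDir.toLabel, TreeStep] at h1
      rw [h1.2.2.2.1, ← hm]
      omega
  have hP : ∀ m u, (co u).level = m → o u ≠ some (.pointer .P) := by
    intro m
    induction m with
    | zero =>
      intro u hm hu
      obtain ⟨v, p', h1, h2, h3⟩ := next u _ hu
      simp only [PointerDir.toLabel, TreeStep] at h1
      omega
    | succ m ih =>
      intro u hm hu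
      obtain ⟨v, p', h1, h2, h3⟩ := next u _ hu
      obtain rfl | rfl | rfl := h3
      · refine ih v ?_ h2
        simp only [PointerDir.toLabel, TreeStep] at h1
        omega
      · exact hL _ v rfl h2
      · exact hR _ v rfl h2
  have hC : ∀ m u, k - (co u).level = m → o u ≠ some (.pointer .ChR) := by
    intro m
    induction m using Nat.strong_induction_on with
    | _ m ih =>
      intro u hm hu
      obtain ⟨v, p', h1, h2, h3⟩ := next u _ hu
      obtain rfl | rfl | rfl := h3
      · refine ih _ ?_ v rfl h2
        have := h1.2.1.2.1
        simp only [PointerDir.toLabel, TreeStep] at h1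
        omega
      · exact hL _ v rfl h2
      · exact hR _ v rfl h2
  match hu : o u with
  | none => rfl
  | some .error => exact absurd hu (herr u)
  | some (.pointer .L) => exact absurd hu (hL _ u rfl)
  | some (.pointer .R) => exact absurd hu (hR _ u rfl)
  | some (.pointer .P) => exact absurd hu (hP _ u rfl)
  | some (.pointer .ChR) => exact absurd hu (hC _ u rfl)

variable (hco : IsLayout k co)
  (hout : PiValid (treeGrid k co) (treeGridInput k co β) (treeGridHalf k co) out)

include hco hout

theorem not_isMark (u : X) : ¬ IsMark (out u).toBadGraph := by
  have h := (hout u).badGraph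
  rintro (hu | hu | hu)
  · obtain ⟨v, hv, hne⟩ | ⟨hi, v, hv, hg⟩ := h.error hu
    · exact hne (treeGridHalf_type hv)
    · obtain ⟨g, hg⟩ := EdgeLabel.exists_valG hg
      have := (treeGrid_adj_and_half.1 ⟨hv, rfl⟩).gridStep hg
      exact treeGridInput_fst_eq_treeNode.1 hi ⟨this.1, this.2.2.1⟩
  · exact h.treeError hu (hco.treeOK u)
  · exact (h.gridError hu).2 (hco.vGridOK u)

/-- No node violates a constraint or is marked, so no error can end a pointer chain, and all
`ColumnError` outputs are excluded as well. -/
theorem eq_vertError_of_bad {u : X} {o : BadGraphProof} (hu : out u = .bad o) : o = .vertError := by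
  have hn := hco.badTree_eq_none (fun u => (hout u).badGraph.badTree)
    (fun u hu => ((hout u).badGraph.badTree.error hu).elim
      (fun h => h (hco.treeOK u)) (not_isMark hco hout u)) u
  have hm := not_isMark hco hout u
  rw [hu] at hn hm
  cases o with
  | vertError => rfl
  | error => exact absurd (.inl rfl) hm
  | treeError => exact absurd (.inr (.inl rfl)) hm
  | gridError => exact absurd (.inr (.inr rfl)) hm
  | columnError l => cases hn

theorem vertError_of_treeStep {u v : X} {t : TreeLabel} (h : TreeStep k t (co u) (co v))
    (hu : out u = .bad .vertError) : out v = .bad .vertError := by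
  have := ((hout u).badGraph.vertError (by rw [hu]; rfl)).1 v (treePart_adj_and_half.2 h).1
  match hv : out v with
  | .bad o => rw [eq_vertError_of_bad hco hout hv]
  | .grid b x => simp [hv, PiOutput.toBadGraph] at this
  | .tree x => simp [hv, PiOutput.toBadGraph] at this

/-- `VertError` spreads along tree edges; here it climbs parent edges to the root of the column, and
`vertError_of_root` brings it down to all other nodes. -/
theorem vertError_root (j : ℕ) : ∀ u, (co u).Valid k → (co u).level = j →
    out u = .bad .vertError → ∀ v, co v = ⟨(co u).col, 0, 0⟩ → out v = .bad .vertError := by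
  induction j with
  | zero =>
    intro u hu hl ho v hv
    have : v = u := hco.injective (by
      have := hu.2.2
      rw [hl] at this
      ext <;> rw [hv] <;> simp <;> omega)
    rwa [this]
  | succ j ih =>
    intro u hu hl ho v hv
    obtain ⟨q, hq⟩ := exists_treeStep_parent.2 ⟨hu, by omega⟩
    obtain ⟨w, rfl⟩ := hco.exists_eq q hq.2.1
    refine ih w hq.2.1 ?_ (vertError_of_treeStep hco hout hq ho) v ?_
    · simp only [TreeStep] at hq
      omega
    · rw [hv, hq.2.2.1]

theorem vertError_of_root (j : ℕ) : ∀ u, (co u).Valid k → (co u).level = j →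
    ∀ v, co v = ⟨(co u).col, 0, 0⟩ → out v = .bad .vertError → out u = .bad .vertError := by
  induction j with
  | zero =>
    intro u hu hl v hv ho
    have : v = u := hco.injective (by
      have := hu.2.2
      rw [hl] at this
      ext <;> rw [hv] <;> simp <;> omega)
    rwa [← this]
  | succ j ih =>
    intro u hu hl v hv ho
    obtain ⟨q, hq⟩ := exists_treeStep_parent.2 ⟨hu, by omega⟩
    obtain ⟨w, rfl⟩ := hco.exists_eq q hq.2.1
    have hw : out w = .bad .vertError := by
      refine ih w hq.2.1 ?_ v ?_ ho
      · simp only [TreeStep] at hq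
        omega
      · rw [hv, hq.2.2.1]
    obtain h | h := TreeStep.parent_iff.1 hq <;> exact vertError_of_treeStep hco hout h hw

/-- Only isolated nodes have bad outputs in a valid solution. -/
theorem not_bad {u : X} (hu : (co u).Valid k) (o : BadGraphProof) : out u ≠ .bad o := by
  intro ho
  rw [eq_vertError_of_bad hco hout ho] at ho
  obtain ⟨v, hv⟩ := hco.exists_eq ⟨(co u).col, 0, 0⟩ ⟨hu.1, Nat.zero_le _, by simp⟩
  have hr := vertError_root hco hout _ u hu rfl ho v hv
  -- The diagonal leaf of the column: it is labelled `1`, so it must not output `VertError`.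
  have hw : Pos.Valid k ⟨(co u).col, k, (co u).col⟩ := ⟨hu.1, le_rfl, hu.1⟩
  obtain ⟨w, hw'⟩ := hco.exists_eq _ hw
  have := vertError_of_root hco hout k w (hw' ▸ hw) (by rw [hw']) v (by rw [hv, hw']) hr
  refine ((hout w).badGraph.vertError (by rw [this]; rfl)).2 ?_
  rw [treeGridInput_fst_eq_one, hw']
  exact ⟨hw, rfl, rfl⟩

theorem exists_grid {u : X} (hu : (co u).Valid k) (hk : (co u).level = k) :
    ∃ b x, out u = .grid b x := by
  obtain ⟨o, ho⟩ | h := (hout u).gridNode (decide ((co u).idx = (co u).col))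
    (by simp [treeGridInput, hu, hk])
  · exact absurd ho (not_bad hco hout hu o)
  · exact h

theorem exists_tree {u : X} (hu : (co u).Valid k) (hk : (co u).level ≠ k) :
    ∃ x, out u = .tree x := by
  obtain ⟨o, ho⟩ | h := (hout u).treeNode (treeGridInput_fst_eq_treeNode.2 fun h => hk h.2)
  · exact absurd ho (not_bad hco hout hu o)
  · exact h

/-- All nodes of a row output the same bit. -/
theorem row_constant {i : ℕ} {u : X} (hu : co u = ⟨0, k, i⟩) {b x : Bool} (ho : out u = .grid b x)
    (c : ℕ) : ∀ v, (co v).Valid k → co v = ⟨c, k, i⟩ → ∃ x', out v = .grid b x' := by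
  induction c with
  | zero =>
    intro v _ hv
    exact ⟨x, hco.injective (hv.trans hu.symm) ▸ ho⟩
  | succ c ih =>
    intro v hval hv
    have hv1 := hval
    rw [hv] at hv1
    have hw : Pos.Valid k ⟨c, k, i⟩ := ⟨(Nat.lt_succ_self c).trans hv1.1, hv1.2⟩
    obtain ⟨w, hw'⟩ := hco.exists_eq _ hw
    obtain ⟨x', hx'⟩ := ih w (hw' ▸ hw) hw'
    have hs : Step k .gridR (co w) (co v) := by
      rw [hv, hw']
      exact ⟨hw, hv1, rfl, rfl, rfl, rfl⟩
    obtain ⟨o, ho⟩ | h := (hout w).row b x' hx' v (hco.treeGrid_leads.2 hs)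
    · exact absurd ho (not_bad hco hout hval o)
    · exact h

/-- The root must say `yes`, and every inner `yes` is justified by a child, so a path of `yes`
descends to a leaf. For `k = 0` the root would itself be a grid node and nothing would be forced. -/
theorem exists_happy (hk : k ≠ 0) {c : ℕ} (hc : c < 2 ^ k) (j : ℕ) (hj : j ≤ k) :
    ∃ u, (co u).Valid k ∧ (co u).col = c ∧ (co u).level = j ∧ (out u).happy = some true := by
  induction j with
  | zero =>
    have hw : Pos.Valid k ⟨c, 0, 0⟩ := ⟨hc, hj, by simp⟩
    obtain ⟨u, hu⟩ := hco.exists_eq _ hw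
    refine ⟨u, hu ▸ hw, by rw [hu], by rw [hu], ?_⟩
    obtain ⟨x, hx⟩ := exists_tree hco hout (hu ▸ hw) (by rw [hu]; exact hk.symm)
    have hP : ¬ ∃ v, Leads (treeGrid k co) (treeGridHalf k co) u [.tree .P] v := by
      rintro ⟨v, hv⟩
      rw [hco.treeGrid_leads, hu] at hv
      simp only [Step, TreeStep] at hv
      omega
    rw [hx, (hout u).root x hx hP]
    rfl
  | succ j ih =>
    obtain ⟨u, hu, huc, hul, hh⟩ := ih (by omega)
    obtain ⟨x, hx⟩ := exists_tree hco hout hu (by omega)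
    rw [hx] at hh
    cases hh
    obtain ⟨v, hv, hv'⟩ := ((hout u).children _ hx).2.1 rfl
    rw [hco.treeGrid_leads, hco.treeGrid_leads] at hv
    refine ⟨v, ?_⟩
    obtain hv | hv := hv <;>
      refine ⟨hv.1.2.1, ?_, ?_, hv'⟩ <;> simp only [Step, TreeStep] at hv <;> omega

/-- Some row outputs the input bit of its last node. -/
theorem exists_row_eq (hk : k ≠ 0) :
    ∃ i < 2 ^ k, ∀ u, co u = ⟨0, k, i⟩ → ∃ x, out u = .grid (β i) x := by
  have hpos : 0 < 2 ^ k := Nat.two_pow_pos k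
  obtain ⟨v, hv, hc, hl, hh⟩ := exists_happy hco hout hk (Nat.sub_lt hpos Nat.one_pos) k le_rfl
  have hi : (co v).idx < 2 ^ k := hl ▸ hv.2.2
  have hpv : co v = ⟨2 ^ k - 1, k, (co v).idx⟩ := by ext <;> simp [hc, hl]
  refine ⟨(co v).idx, hi, fun u hu => ?_⟩
  have huv : (co u).Valid k := by
    rw [hu]
    exact ⟨hpos, le_rfl, hi⟩
  obtain ⟨b, x, ho⟩ := exists_grid hco hout huv (by rw [hu])
  obtain ⟨x', hx'⟩ := row_constant hco hout hu ho _ v hv hpv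
  rw [hx'] at hh
  cases hh
  have hR : ¬ ∃ w, Leads (treeGrid k co) (treeGridHalf k co) v [.gridR] w := by
    rintro ⟨w, hw⟩
    have hw' : GridStep k .R (co v) (co w) := hco.treeGrid_leads.1 hw
    have := hw'.2.1.1
    simp only [GridStep] at hw'
    omega
  have hb := ((hout v).rowEnd b true hx' hR).1 rfl
  have : (treeGridInput k co β v).2 = β (co v).idx := by
    simp only [treeGridInput, hc]
    rw [if_pos (by omega)]
  exact ⟨x, by rw [ho, ← hb, this]⟩

/-- The first and the last node of a row output the same bit. -/
theorem exists_row_ends {i : ℕ} (hi : i < 2 ^ k) {u v : X} (hu : co u = ⟨0, k, i⟩)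
    (hv : co v = ⟨2 ^ k - 1, k, i⟩) :
    ∃ b, (∃ x, out u = .grid b x) ∧ ∃ x, out v = .grid b x := by
  have hpos : 0 < 2 ^ k := Nat.two_pow_pos k
  have huv : (co u).Valid k := by
    rw [hu]
    exact ⟨hpos, le_rfl, hi⟩
  obtain ⟨b, x, ho⟩ := exists_grid hco hout huv (by rw [hu])
  refine ⟨b, ⟨x, ho⟩, row_constant hco hout hu ho _ v ?_ hv⟩
  rw [hv]
  exact ⟨Nat.sub_lt hpos Nat.one_pos, le_rfl, hi⟩

end Forced

end PiProblem

/-! ### Embedding the instance into `n` nodes; distances between columns -/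

namespace PiProblem

open Finset in
/-- A set of at least `2 * 4 ^ k` nodes has a layout. -/
theorem exists_isLayout {k n : ℕ} (hn : 2 * 4 ^ k ≤ n) :
    ∃ co : Fin n → Pos, IsLayout k co := by
  -- Surplus nodes are placed at invalid positions, of which there must be enough.
  have : Infinite Pos := Infinite.of_injective (fun c => (⟨c, 0, 0⟩ : Pos)) fun a b h => by
    simpa using h
  let S : Finset Pos := (range (2 ^ k)).biUnion fun c => (range (k + 1)).biUnion fun j =>
    (range (2 ^ j)).image fun i => ⟨c, j, i⟩
  have hS : #S ≤ n := by
    have h1 : ∀ c, #((range (k + 1)).biUnion fun j =>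
        (range (2 ^ j)).image fun i => (⟨c, j, i⟩ : Pos)) ≤ 2 * 2 ^ k := fun c => calc
      _ ≤ ∑ j ∈ range (k + 1), #((range (2 ^ j)).image fun i => (⟨c, j, i⟩ : Pos)) :=
        card_biUnion_le
      _ ≤ ∑ j ∈ range (k + 1), 2 ^ j :=
        sum_le_sum fun j _ => card_image_le.trans (card_range _).le
      _ ≤ 2 * 2 ^ k := by
        rw [Nat.geomSum_eq le_rfl, pow_succ]
        simp only [Nat.add_one_sub_one, Nat.div_one]
        omega
    calc #S ≤ ∑ c ∈ range (2 ^ k), 2 * 2 ^ k := card_biUnion_le.trans (sum_le_sum fun c _ => h1 c)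
      _ = 2 * 4 ^ k := by
        rw [sum_const, card_range, smul_eq_mul, show (4 : ℕ) = 2 * 2 from rfl, mul_pow]
        ring
      _ ≤ n := hn
  obtain ⟨S', hSS', hcard⟩ := Infinite.exists_superset_card_eq S n hS
  let e : Fin n ≃ S' := (finCongr hcard.symm).trans S'.equivFin.symm
  refine ⟨fun x => e x, Subtype.val_injective.comp e.injective, fun p hp => ?_⟩
  have hpS : p ∈ S := by
    simp only [S, mem_biUnion, mem_range, mem_image]
    exact ⟨p.col, hp.1, p.level, Nat.lt_succ_of_le hp.2.1, p.idx, hp.2.2, rfl⟩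
  exact ⟨e.symm ⟨p, hSS' hpS⟩, by simp⟩

/-- The trees lie within columns and give no shortcuts: one edge advances by at most one column. -/
theorem col_le_of_walk {X : Type*} {k : ℕ} {co : X → Pos} {u v : X}
    (w : (treeGrid k co).Walk u v) : (co v).col ≤ (co u).col + w.length := by
  induction w with
  | nil => simp
  | cons h w ih =>
    obtain ⟨l, hl⟩ := id h
    have := hl.col_le
    rw [SimpleGraph.Walk.length_cons]
    omega

end PiProblem

/-! ### The adversary: processing order, independence of row ends, and flipped bits -/

namespace SLOCAL

open PiProblem MeasureTheory

/-- The network on `treeGrid` with the bits `β` in the last column. -/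
noncomputable def gridNetwork {n : ℕ} (k : ℕ) (co : Fin n → Pos) (β : ℕ → Bool) :
    Network n (NodeLabel × Bool) EdgeLabel where
  graph := treeGrid k co
  nodeInput := treeGridInput k co β
  halfInput := treeGridHalf k co
  ident v := v + 1
  ident_injective _ _ h := Fin.ext (Nat.succ_injective h)

section

variable {n k T : ℕ} {co : Fin n → Pos} {β β' : ℕ → Bool}

theorem col_le_of_mem_ball {u v : Fin n} (h : v ∈ (gridNetwork k co β).ball T u) :
    (co v).col ≤ (co u).col + T := by
  have h : (treeGrid k co).edist u v ≤ (T : ℕ∞) := h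
  obtain ⟨w, hw⟩ := SimpleGraph.exists_walk_of_edist_ne_top
    (ne_top_of_le_ne_top (ENat.natCast_ne_top T) h)
  rw [← hw, Nat.cast_le] at h
  exact (col_le_of_walk w).trans (by omega)

theorem col_le_of_mem_ball' {u v : Fin n} (h : v ∈ (gridNetwork k co β).ball T u) :
    (co u).col ≤ (co v).col + T := by
  refine col_le_of_mem_ball (k := k) (β := β) ?_
  have h : (treeGrid k co).edist u v ≤ (T : ℕ∞) := h
  rw [SimpleGraph.edist_comm] at h
  exact h

/-- Nodes in the first column do not see the bits in the last column. -/
theorem gridNetwork_view_eq (hT : T + 1 < 2 ^ k) {v : Fin n} (hv : (co v).col = 0) :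
    (gridNetwork k co β').view T v = (gridNetwork k co β).view T v := by
  have hnodes : ((gridNetwork k co β').view T v).nodes = ((gridNetwork k co β).view T v).nodes := by
    ext p
    refine exists_congr fun w => and_congr_right fun hw => ?_
    -- The bits `β` enter only through the inputs of column `2 ^ k - 1`, more than `T` columns away.
    have hw' : (co w).col + 1 ≠ 2 ^ k := by
      have := col_le_of_mem_ball (β := β') hw
      omega
    have : (gridNetwork k co β').nodeInput w = (gridNetwork k co β).nodeInput w := by
      simp [gridNetwork, treeGridInput, hw']
    rw [this]
    rfl
  simp only [Network.view] at hnodes ⊢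
  rw [hnodes]
  rfl

/-- The leaves in the column `c`. -/
noncomputable def leaves (k : ℕ) (co : Fin n → Pos) (c : ℕ) : Finset (Fin n) :=
  {v | (co v).col = c ∧ (co v).level = k}

/-- The leaves of the first column are processed first, then those of the last column. -/
noncomputable def processingOrder (k : ℕ) (co : Fin n → Pos) : Equiv.Perm (Fin n) :=
  Tuple.sort fun v => if v ∈ leaves k co 0 then 0 else if v ∈ leaves k co (2 ^ k - 1) then 1 else 2

theorem mem_leaves_of_processed_before {i j : Fin n} (hij : i < j)
    (hj : processingOrder k co j ∈ leaves k co 0) : processingOrder k co i ∈ leaves k co 0 := by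
  have := Tuple.monotone_sort (fun v => if v ∈ leaves k co 0 then 0 else
    if v ∈ leaves k co (2 ^ k - 1) then 1 else 2) hij.le
  by_contra hi
  change (if processingOrder k co i ∈ leaves k co 0 then 0 else
    if processingOrder k co i ∈ leaves k co (2 ^ k - 1) then 1 else 2) ≤
    (if processingOrder k co j ∈ leaves k co 0 then 0 else
    if processingOrder k co j ∈ leaves k co (2 ^ k - 1) then 1 else 2) at this
  rw [if_pos hj, if_neg hi] at this
  split_ifs at this <;> omega

theorem mem_leaves_or_of_processed_before {i j : Fin n} (hij : i < j)
    (hj : processingOrder k co j ∈ leaves k co (2 ^ k - 1)) :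
    processingOrder k co i ∈ leaves k co 0 ∨
      processingOrder k co i ∈ leaves k co (2 ^ k - 1) := by
  have := Tuple.monotone_sort (fun v => if v ∈ leaves k co 0 then 0 else
    if v ∈ leaves k co (2 ^ k - 1) then 1 else 2) hij.le
  by_contra! hi
  change (if processingOrder k co i ∈ leaves k co 0 then 0 else
    if processingOrder k co i ∈ leaves k co (2 ^ k - 1) then 1 else 2) ≤
    (if processingOrder k co j ∈ leaves k co 0 then 0 else
    if processingOrder k co j ∈ leaves k co (2 ^ k - 1) then 1 else 2) at this
  rw [if_neg hi.1, if_neg hi.2, if_pos hj] at this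
  split_ifs at this <;> omega

variable (A : RandAlgorithm.{u} (NodeLabel × Bool) EdgeLabel PiOutput)

/-- The outputs in the first column depend neither on the bits in the last column nor on the
random bits of other nodes. -/
theorem run_first_congr (hT : T + 1 < 2 ^ k) {r r' : Fin n → ℕ → Bool}
    (hr : ∀ v ∈ leaves k co 0, r v = r' v) {v : Fin n} (hv : v ∈ leaves k co 0) :
    A.run (gridNetwork k co β) T (processingOrder k co) r v =
      A.run (gridNetwork k co β') T (processingOrder k co) r' v :=
  A.run_congr (gridNetwork k co β) (gridNetwork k co β') T _ (leaves k co 0 : Set (Fin n)) rfl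
    (fun v hv => gridNetwork_view_eq hT (by
      simp only [leaves, Finset.coe_filter, Set.mem_ofPred_eq] at hv
      exact hv.2.1))
    (fun _ _ => rfl) r r' hr (fun _ _ hij hj _ => mem_leaves_of_processed_before hij hj) hv

/-- The outputs in the last column do not depend on the random bits of other nodes. -/
theorem run_last_congr (hT : T + 1 < 2 ^ k) {r r' : Fin n → ℕ → Bool}
    (hr : ∀ v ∈ leaves k co (2 ^ k - 1), r v = r' v) {v : Fin n}
    (hv : v ∈ leaves k co (2 ^ k - 1)) :
    A.run (gridNetwork k co β) T (processingOrder k co) r v =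
      A.run (gridNetwork k co β) T (processingOrder k co) r' v := by
  refine A.run_congr _ _ T _ (leaves k co (2 ^ k - 1) : Set (Fin n)) rfl
    (fun _ _ => rfl) (fun _ _ => rfl) r r' hr (fun i j hij hj hb => ?_) hv
  -- Leaves of the first column are processed earlier but lie outside the ball, since the columns
  -- are `2 ^ k - 1 > T` apart.
  refine (mem_leaves_or_of_processed_before hij hj).resolve_left fun hi => ?_
  have := col_le_of_mem_ball' hb
  simp only [leaves, Finset.mem_filter, Finset.coe_filter, Set.mem_ofPred_eq] at hi hj
  omega

theorem disjoint_leaves {c c' : ℕ} (h : c ≠ c') : Disjoint (leaves k co c) (leaves k co c') := by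
  refine Finset.disjoint_filter.2 fun v _ h1 h2 => h (h1.1.symm.trans h2.1)

/-- The event that the node `v` outputs a pair with first component `b`. -/
def rowBit (A : RandAlgorithm.{u} (NodeLabel × Bool) EdgeLabel PiOutput) (T k : ℕ)
    (co : Fin n → Pos) (β : ℕ → Bool) (v : Fin n) (b : Bool) : Set (Fin n → ℕ → Bool) :=
  {r | ∃ x, A.run (gridNetwork k co β) T (processingOrder k co) r v = .grid b x}

theorem measurableSet_rowBit (v : Fin n) (b : Bool) : MeasurableSet (rowBit A T k co β v b) := by
  simp only [rowBit, Set.ofPred_exists]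
  exact MeasurableSet.iUnion fun x => A.measurableSet_run_eq _ _ _ _ _

theorem disjoint_rowBit (v : Fin n) : Disjoint (rowBit A T k co β v true)
    (rowBit A T k co β v false) := by
  refine Set.disjoint_left.2 ?_
  rintro r ⟨x, hx⟩ ⟨y, hy⟩
  rw [hx] at hy
  cases hy

theorem rowBit_add_le_one (v : Fin n) :
    (privateBits n).real (rowBit A T k co β v true) +
      (privateBits n).real (rowBit A T k co β v false) ≤ 1 := by
  rw [← measureReal_union (disjoint_rowBit A v) (measurableSet_rowBit A v false)]
  exact measureReal_le_one

theorem SolvesPi.le_real_valid {A : RandAlgorithm.{u} (NodeLabel × Bool) EdgeLabel PiOutput}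
    {c : ℕ} (hc : 1 ≤ c) (hA : SolvesPi A c n T) (hco : IsLayout k co) (β : ℕ → Bool) :
    1 - 1 / (n : ℝ) ≤ (privateBits n).real
      {r | PiValid (treeGrid k co) (treeGridInput k co β) (treeGridHalf k co)
        (A.run (gridNetwork k co β) T (processingOrder k co) r)} := by
  refine hA (gridNetwork k co β) (fun v => ⟨Nat.succ_pos _, ?_⟩)
    ⟨_, hco.piValid_treeGridSolution⟩ (processingOrder k co)
  exact (Nat.succ_le_of_lt v.2).trans (Nat.le_self_pow (by omega) n)

/-- The bit of a row is almost determined by the topology, the identifiers and the algorithm. -/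
theorem SolvesPi.exists_rowBit {A : RandAlgorithm.{u} (NodeLabel × Bool) EdgeLabel PiOutput}
    {c : ℕ} (hc : 1 ≤ c) (hA : SolvesPi A c n T) (hco : IsLayout k co) (hT : T + 1 < 2 ^ k)
    {i : ℕ} (hi : i < 2 ^ k) {u : Fin n} (hu : co u = ⟨0, k, i⟩) :
    ∃ b, 1 - 1 / (n : ℝ) ≤ (privateBits n).real (rowBit A T k co β u b) := by
  obtain ⟨v, hv⟩ := hco.exists_eq ⟨2 ^ k - 1, k, i⟩
    ⟨Nat.sub_lt (Nat.two_pow_pos k) Nat.one_pos, le_rfl, hi⟩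
  have hmu : u ∈ leaves k co 0 := by simp [leaves, hu]
  have hmv : v ∈ leaves k co (2 ^ k - 1) := by simp [leaves, hv]
  have hind : ∀ b, (privateBits n).real (rowBit A T k co β u b ∩ rowBit A T k co β v b) =
      (privateBits n).real (rowBit A T k co β u b) *
        (privateBits n).real (rowBit A T k co β v b) := by
    intro b
    refine privateBits_inter (disjoint_leaves (k := k) (co := co) (by omega : 0 ≠ 2 ^ k - 1))
      (measurableSet_rowBit A u b) (measurableSet_rowBit A v b) ?_ ?_
    · rintro r r' hr ⟨x, hx⟩
      exact ⟨x, by rw [← hx, run_first_congr (β := β) (β' := β) A hT hr hmu]⟩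
    · rintro r r' hr ⟨x, hx⟩
      exact ⟨x, by rw [← hx, run_last_congr (β := β) A hT hr hmv]⟩
  -- In a valid run the two ends agree, so the success probability is at most `p₁ q₁ + p₀ q₀` after
  -- independence is applied.
  have hle := (hA.le_real_valid hc hco β).trans <|
    (measureReal_mono (s₂ := rowBit A T k co β u true ∩ rowBit A T k co β v true ∪
      rowBit A T k co β u false ∩ rowBit A T k co β v false) (by
      intro r hr
      obtain ⟨b, h1, h2⟩ := exists_row_ends hco hr hi hu hv
      cases b
      exacts [.inr ⟨h1, h2⟩, .inl ⟨h1, h2⟩])).trans (measureReal_union_le _ _)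
  rw [hind, hind] at hle
  have hsum := rowBit_add_le_one (T := T) (k := k) (co := co) (β := β) A v
  have h0 : ∀ w b, 0 ≤ (privateBits n).real (rowBit A T k co β w b) := fun _ _ =>
    measureReal_nonneg
  -- The likelier bit at `u` works: since `q₁ + q₀ ≤ 1`, the sum `p₁ q₁ + p₀ q₀` is at most the
  -- larger of `p₁`, `p₀`.
  obtain h | h := le_total ((privateBits n).real (rowBit A T k co β u true))
    ((privateBits n).real (rowBit A T k co β u false))
  · exact ⟨false, by nlinarith [h0 v true, h0 v false, h0 u false]⟩
  · exact ⟨true, by nlinarith [h0 v true, h0 v false, h0 u true]⟩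

/-- If the first column cannot see the last, the input bits can be chosen against the preferred bits
of the rows, and a union bound over the rows refutes correctness. -/
theorem SolvesPi.two_pow_le {A : RandAlgorithm.{u} (NodeLabel × Bool) EdgeLabel PiOutput}
    {c : ℕ} (hc : 1 ≤ c) (hn : 2 * 4 ^ k ≤ n) (hA : SolvesPi A c n T) : 2 ^ k ≤ T + 1 := by
  by_contra! hT
  obtain ⟨co, hco⟩ := exists_isLayout hn
  have hk : k ≠ 0 := by rintro rfl; simp at hT
  have hfirst : ∀ i : Fin (2 ^ k), ∃ u, co u = ⟨0, k, i⟩ := fun i =>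
    hco.exists_eq _ ⟨Nat.two_pow_pos k, le_rfl, i.2⟩
  choose first hfirst using hfirst
  have hmem : ∀ i, first i ∈ leaves k co 0 := fun i => by simp [leaves, hfirst]
  choose g hg using fun i : Fin (2 ^ k) =>
    hA.exists_rowBit (β := fun _ => false) hc hco hT i.2 (hfirst i)
  -- The preferred bits `g` were obtained with all input bits `false`; flipping them is harmless
  -- because the first column behaves identically under both inputs.
  let β : ℕ → Bool := fun i => if h : i < 2 ^ k then !(g ⟨i, h⟩) else false
  have hsub : {r | PiValid (treeGrid k co) (treeGridInput k co β) (treeGridHalf k co)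
      (A.run (gridNetwork k co β) T (processingOrder k co) r)} ⊆
      ⋃ i, (rowBit A T k co (fun _ => false) (first i) (g i))ᶜ := by
    intro r hr
    obtain ⟨i, hi, h⟩ := exists_row_eq hco hr hk
    obtain ⟨x, hx⟩ := h (first ⟨i, hi⟩) (hfirst _)
    refine Set.mem_iUnion.2 ⟨⟨i, hi⟩, ?_⟩
    rintro ⟨y, hy⟩
    rw [run_first_congr (β' := β) A hT (fun _ _ => rfl) (hmem _), hx] at hy
    simp [β, hi] at hy
  have hle := (hA.le_real_valid hc hco β).trans <| (measureReal_mono hsub).trans <|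
    (measureReal_iUnion_fintype_le _).trans <| Finset.sum_le_sum (g := fun _ => 1 / (n : ℝ))
      fun i _ => by
        rw [probReal_compl_eq_one_sub (measurableSet_rowBit A _ _)]
        linarith [hg i]
  rw [Finset.sum_const, Finset.card_univ, Fintype.card_fin, nsmul_eq_mul] at hle
  have h4 : (4 : ℕ) ^ k = 2 ^ k * 2 ^ k := by rw [← mul_pow]; rfl
  have hn0 : (0 : ℝ) < n := by
    have : 0 < 4 ^ k := Nat.pow_pos (by norm_num)
    exact_mod_cast (by omega : 0 < n)
  have h2 : 2 ≤ 2 ^ k := Nat.le_self_pow hk 2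
  -- This is `1 - 1/n ≤ 2 ^ k / n` cleared of denominators; it contradicts `n ≥ 2 * 4 ^ k`.
  have : (n : ℝ) ≤ 2 ^ k + 1 := by
    have := mul_le_mul_of_nonneg_right hle hn0.le
    field_simp at this
    push_cast at this
    linarith
  have : n ≤ 2 ^ k + 1 := by exact_mod_cast this
  nlinarith

end

end SLOCAL

theorem mainTheorem3 :
    ∃ C : ℝ, 0 < C ∧ ∃ n₀ : ℕ,
      ∀ c : ℕ, 1 ≤ c →
      ∀ A : SLOCAL.RandAlgorithm.{u} (PiProblem.NodeLabel × Bool) PiProblem.EdgeLabel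
        PiProblem.PiOutput,
      ∀ T : ℕ → ℕ, ∀ n : ℕ, n₀ ≤ n → SLOCAL.SolvesPi A c n (T n) →
        C * Real.sqrt (n : ℝ) ≤ (T n : ℝ) := by
  -- From `n ≥ 8` one gets `k ≥ 1`, so `2 ^ k ≤ T + 1` improves to `2 ^ k ≤ 2T`. Maximality of `k`
  -- gives `n ≤ 8 * 4 ^ k ≤ 32 T²`, which is rounded up to `(6T)²`.
  refine ⟨1 / 6, by norm_num, 8, fun c hc A T n hn hA => ?_⟩
  set k := Nat.log 4 (n / 2) with hk
  have hk1 : k ≠ 0 := (Nat.log_pos (by norm_num) (by omega)).ne'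
  have h1 : 4 ^ k ≤ n / 2 := Nat.pow_log_le_self 4 (by omega)
  have h2 : n / 2 < 4 ^ (k + 1) := Nat.lt_pow_succ_log_self (by norm_num) _
  have hT := hA.two_pow_le (k := k) hc (by omega)
  have h4 : (4 : ℕ) ^ k = 2 ^ k * 2 ^ k := by rw [← mul_pow]; rfl
  have h5 : 2 ≤ 2 ^ k := Nat.le_self_pow hk1 2
  rw [pow_succ] at h2
  have h6 : n ≤ (6 * T n) ^ 2 := by
    have : 2 ^ k ≤ 2 * T n := by omega
    have : n ≤ 8 * (2 ^ k * 2 ^ k) := by omega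
    nlinarith
  have h7 : Real.sqrt n ≤ 6 * T n := by
    refine Real.sqrt_le_iff.2 ⟨by positivity, by exact_mod_cast h6⟩
  linarith
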